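/- Fix a constant $B>1$ and an integer $r\ge 1$. For each $n$ let $p=p_n$, $q=q_n$, $s_x\le p$, $s_y\le q$ and $D_n$ be natural numbers, and let $Q_n$ be the law of $n$ i.i.d. $N(0,I_{p+q})$ vectors. **Model.** For $k\ge1$ let $\mathcal P_G(k,s_x,s_y,B)$ be the set of centered Gaussian laws of $(X,Y)\in\mathbb R^p\times\mathbb R^q$ such that: $\operatorname{rank}\Sigma_{xy}=k$; the first $k$ canonical correlations $\Lambda_1\ge\dots\ge\Lambda_k$ are at least $1/B$ and satisfy $\Lambda_{i}-\Lambda_{i+1}\ge 1/B$; the matrices $U$, $V$ of the first $k$ canonical directions have exactly $s_x$ and $s_y$ nonzero rows; and all eigenvalues of $\Sigma_x$ and $\Sigma_y$ lie strictly between $1/B$ and $B$. Write $D(U)$, $D(V)$ for the sets of indices of nonzero rows, and let $\mathcal M_n=\bigcup_{1\le k\le r}\mathcal P_G(k,s_x,s_y,B)$ (so $\mathcal M_n=\mathcal P_G(1,s_x,s_y,B)$ if $r=1$). **Tests.** A test $\Phi_n$ is a $\{0,1\}$-valued function of the sample. It is time-$n^{t(n)}$ if, for all large $n$, it is computed by a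 program for a real-number random access machine (unit-cost exact arithmetic and comparisons) whose length and worst-case number of steps are both $O(n^{t(n)})$; the program may depend on $n$. Tests $\Phi_n$ strongly distinguish laws $P_n$ and $Q_n$ of the sample if $Q_n(\Phi_n=1)+P_n(\Phi_n=0)\to0$, and they strongly distinguish $\mathcal M_n$ from the null if $\liminf_n\{Q_n(\Phi_n=1)+\sup_{P\in\mathcal M_n}P^{\otimes n}(\Phi_n=0)\}=0$. **Low-degree conjecture** for a class $\mathcal N$ of ("nice") sequences $(P_n,Q_n)$, with polylogarithmic factor $(\log n)^C$, $C\in\{0,1,2,\dots\}$. For every sequence in $\mathcal N$, restricted to any infinite set of sample sizes $n$, for which $P_n\ll Q_n$ are probability measures and polynomials are in $L^1(P_n)$ and $L^2(Q_n)$, and for every $t:\mathbb N\to\{1,2,\dots\}$: if $$\|L_n^{\le D_n'}\|_{L_2(Q_n)}:=\sup_{\deg f\le D'_n}\frac{E_{P_n}f}{\sqrt{E_{Q_n}f^2}}=O(1)$$ for every sequence $D'_n\le t(n)(\log n)^C$, then no time-$n^{t(n)}$ test strongly distinguishes $P_n$ and $Q_n$. **Statement.** Suppose that for all large $n$ $$s_x,s_y\ge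 \frac{2\sqrt{e\,n\,D_n}}{B},\qquad p,q\ge\frac{3en}{B^2},\qquad D_n\le\min(\sqrt p,\sqrt q,n).$$ Assume that the low-degree conjecture with factor $(\log n)^C$ holds for a class $\mathcal N$ that contains the sequence $(P_n,Q_n)_n$, where $P_n$ is the law of the following sample: draw independently $\alpha$ uniform over the vectors in $\{0,\pm1/\sqrt{s_x}\}^p$ with exactly $s_x$ nonzero entries and $\beta$ uniform over the vectors in $\{0,\pm1/\sqrt{s_y}\}^q$ with exactly $s_y$ nonzero entries, and given $(\alpha,\beta)$ draw $n$ i.i.d. observations from $N\Big(0,\begin{pmatrix}I_p&B^{-1}\alpha\beta^T\\B^{-1}\beta\alpha^T&I_q\end{pmatrix}\Big)$. Let $t:\mathbb N\to\{1,2,\dots\}$ satisfy $t(n)(\log n)^C\le D_n$ for all large $n$ (that is, consider time $n^{\tilde\Theta(D_n)}$, where $\tilde\Theta$ hides the polylogarithmic factor). Then: 1. no time-$n^{t(n)}$ test strongly distinguishes $\mathcal M_n$ from the null; 2. there are no time-$n^{t(n)}$ decoders $\hat D_x,\hat D_y$ (computed in the same machine model) such that, uniformly over $P\in\mathcal M_n$,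 the probability that $\hat D_x=D(U)$ and $\hat D_y=D(V)$ tends to one, and such that $Q_n(\hat D_x=\emptyset)\to1$ and $Q_n(\hat D_y=\emptyset)\to1$. In particular, if $k(\log n)^C\le D_n$ eventually for every constant $k$, no polynomial-time decoders with these properties exist. -/

import Mathlib

open MeasureTheory ProbabilityTheory Filter Topology Matrix
open scoped ENNReal

noncomputable section

namespace SparseCCA

/-! ### Samples -/

/-- The space of one observation `(X, Y)` with `X ∈ ℝ^p` and `Y ∈ ℝ^q`. -/
abbrev Obs (p q : ℕ) : Type := EuclideanSpace ℝ (Fin p ⊕ Fin q)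

/-- The space of a sample of `n` observations. -/
abbrev Sample (n p q : ℕ) : Type := Fin n → Obs p q

/-- The law of `n` independent observations from `μ`. -/
def iidLaw (n : ℕ) {p q : ℕ} (μ : Measure (Obs p q)) : Measure (Sample n p q) :=
  Measure.pi fun _ : Fin n => μ

/-- The law of one observation under the null: `N(0, I_{p+q})`. -/
def nullLaw (p q : ℕ) : Measure (Obs p q) :=
  multivariateGaussian 0 (1 : Matrix (Fin p ⊕ Fin q) (Fin p ⊕ Fin q) ℝ)

/-! ### The Gaussian sparse CCA model -/

section Model

variable {p q r : ℕ}

/-- `(U, V)` holds the first `r` pairs of canonical directions, as columns, for the covariance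
matrix `S` of `(X, Y)`: the `j`-th pair maximizes `uᵀ Σ_xy v` over all `u, v` with
`uᵀ Σ_x u = vᵀ Σ_y v = 1` and `uᵀ Σ_x u_l = vᵀ Σ_y v_l = 0` for all `l < j`. -/
def IsCanonicalDirections (S : Matrix (Fin p ⊕ Fin q) (Fin p ⊕ Fin q) ℝ)
    (U : Matrix (Fin p) (Fin r) ℝ) (V : Matrix (Fin q) (Fin r) ℝ) : Prop :=
  ∀ j : Fin r,
    let feasible : Set ((Fin p → ℝ) × (Fin q → ℝ)) :=
      {w | w.1 ⬝ᵥ (S.toBlocks₁₁ *ᵥ w.1) = 1 ∧ w.2 ⬝ᵥ (S.toBlocks₂₂ *ᵥ w.2) = 1 ∧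
        ∀ l : Fin r, l < j →
          w.1 ⬝ᵥ (S.toBlocks₁₁ *ᵥ U.col l) = 0 ∧ w.2 ⬝ᵥ (S.toBlocks₂₂ *ᵥ V.col l) = 0}
    (U.col j, V.col j) ∈ feasible ∧
      IsMaxOn (fun w : (Fin p → ℝ) × (Fin q → ℝ) => w.1 ⬝ᵥ (S.toBlocks₁₂ *ᵥ w.2)) feasible
        (U.col j, V.col j)

/-- The canonical correlation attained by the `j`-th pair of canonical directions. -/
def canonicalCorrelation (S : Matrix (Fin p ⊕ Fin q) (Fin p ⊕ Fin q) ℝ)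
    (U : Matrix (Fin p) (Fin r) ℝ) (V : Matrix (Fin q) (Fin r) ℝ) (j : Fin r) : ℝ :=
  U.col j ⬝ᵥ (S.toBlocks₁₂ *ᵥ V.col j)

open Classical in
/-- The support `D(A)` of a matrix: the indices of its nonzero rows. -/
def rowSupport {m : ℕ} (A : Matrix (Fin m) (Fin r) ℝ) : Finset (Fin m) :=
  Finset.univ.filter fun i => A i ≠ 0

/-- `μ` belongs to the Gaussian sparse CCA model with rank `r`, sparsities `sx`, `sy` and
constant `B`, and `U`, `V` are its matrices of canonical directions. -/
structure InModel (sx sy : ℕ) (B : ℝ) (μ : Measure (Obs p q))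
    (U : Matrix (Fin p) (Fin r) ℝ) (V : Matrix (Fin q) (Fin r) ℝ) : Prop where
  exists_cov : ∃ S : Matrix (Fin p ⊕ Fin q) (Fin p ⊕ Fin q) ℝ,
    S.PosSemidef ∧ μ = multivariateGaussian 0 S ∧
    S.toBlocks₁₂.rank = r ∧
    IsCanonicalDirections S U V ∧
    (∀ j, 1 / B ≤ canonicalCorrelation S U V j) ∧
    (∀ i j : Fin r, (i : ℕ) + 1 = j →
      1 / B ≤ canonicalCorrelation S U V i - canonicalCorrelation S U V j) ∧
    (S.toBlocks₁₁ - (1 / B) • (1 : Matrix (Fin p) (Fin p) ℝ)).PosDef ∧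
    (B • (1 : Matrix (Fin p) (Fin p) ℝ) - S.toBlocks₁₁).PosDef ∧
    (S.toBlocks₂₂ - (1 / B) • (1 : Matrix (Fin q) (Fin q) ℝ)).PosDef ∧
    (B • (1 : Matrix (Fin q) (Fin q) ℝ) - S.toBlocks₂₂).PosDef
  card_x : (rowSupport U).card = sx
  card_y : (rowSupport V).card = sy

/-- The Gaussian sparse CCA model with rank at least one and at most `r`. For `r = 1` this is the
model of rank exactly one. -/
def modelG (p q r sx sy : ℕ) (B : ℝ) : Set (Measure (Obs p q)) :=
  {μ | ∃ k : ℕ, 1 ≤ k ∧ k ≤ r ∧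
    ∃ (U : Matrix (Fin p) (Fin k) ℝ) (V : Matrix (Fin q) (Fin k) ℝ), InModel sx sy B μ U V}

end Model

/-! ### Planted distributions -/

/-- `Σ(α, β, ρ)`, with diagonal blocks `I_p`, `I_q` and off-diagonal block `ρ α βᵀ`. -/
def spikedCov {p q : ℕ} (a : Fin p → ℝ) (b : Fin q → ℝ) (ρ : ℝ) :
    Matrix (Fin p ⊕ Fin q) (Fin p ⊕ Fin q) ℝ :=
  Matrix.fromBlocks 1 (ρ • vecMulVec a b) (ρ • vecMulVec b a) 1

open Classical in
/-- `P_{α,β}`: the law `N(0, Σ(α, β, 1/B))` if `‖α‖₂ ‖β‖₂ < B`, and the null law otherwise. -/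
def plantedLaw {p q : ℕ} (B : ℝ) (a : Fin p → ℝ) (b : Fin q → ℝ) : Measure (Obs p q) :=
  if √(∑ i, a i ^ 2) * √(∑ j, b j ^ 2) < B then multivariateGaussian 0 (spikedCov a b (1 / B))
  else nullLaw p q

open Classical in
/-- Sign patterns of length `p` with exactly `s` nonzero entries. -/
def signPatterns (p s : ℕ) : Finset (Fin p → SignType) :=
  Finset.univ.filter fun σ => (Finset.univ.filter fun i => σ i ≠ 0).card = s

/-- The vector with entries `σ_i / √s`. -/
def signVector {p : ℕ} (s : ℕ) (σ : Fin p → SignType) : Fin p → ℝ :=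
  fun i => ((σ i : SignType) : ℝ) / √(s : ℝ)

/-- The law of a sample of `n` observations from `P_{α,β}` where `α` and `β` are independent,
`α` is uniform over the vectors in `{0, ±1/√sx}^p` with exactly `sx` nonzero entries, and `β` is
uniform over the vectors in `{0, ±1/√sy}^q` with exactly `sy` nonzero entries. -/
def plantedMixture (n p q sx sy : ℕ) (B : ℝ) : Measure (Sample n p q) :=
  (((signPatterns p sx).card * (signPatterns q sy).card : ℕ) : ℝ≥0∞)⁻¹ •
    ∑ σ ∈ signPatterns p sx, ∑ τ ∈ signPatterns q sy,
      iidLaw n (plantedLaw B (signVector sx σ) (signVector sy τ))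

/-! ### Low-degree likelihood ratio -/

/-- The value at a sample of a polynomial in the `n (p + q)` coordinates of the sample. -/
def evalPoly {n p q : ℕ} (f : MvPolynomial (Fin n × (Fin p ⊕ Fin q)) ℝ) (x : Sample n p q) : ℝ :=
  MvPolynomial.eval (fun c => x c.1 c.2) f

/-- The norm in `L²(Q)` of the degree-`D` part of the likelihood ratio `dP/dQ`: the supremum of
`E_P[f] / √(E_Q[f²])` over the polynomials `f` of degree at most `D`. -/
def lowDegreeNorm {n p q : ℕ} (P Q : Measure (Sample n p q)) (D : ℕ) : ℝ≥0∞ :=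
  ⨆ f : {f : MvPolynomial (Fin n × (Fin p ⊕ Fin q)) ℝ // f.totalDegree ≤ D},
    ENNReal.ofReal ((∫ x, evalPoly f.1 x ∂P) / √(∫ x, evalPoly f.1 x ^ 2 ∂Q))

/-- The setting in which the likelihood ratio and its low-degree part make sense. -/
structure IsRegular {n p q : ℕ} (P Q : Measure (Sample n p q)) : Prop where
  prob_P : IsProbabilityMeasure P
  prob_Q : IsProbabilityMeasure Q
  absolutelyContinuous : P ≪ Q
  integrable : ∀ f : MvPolynomial (Fin n × (Fin p ⊕ Fin q)) ℝ, Integrable (evalPoly f) P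
  memLp : ∀ f : MvPolynomial (Fin n × (Fin p ⊕ Fin q)) ℝ, MemLp (evalPoly f) 2 Q

/-! ### Real random access machines -/

/-- Instructions of a random access machine with index registers holding natural numbers, real
registers holding real numbers with exact arithmetic, and read-only access to a sample. Registers
are named by natural numbers, and `l` is a line of the program. -/
inductive Instr where
  /-- `idx a := c` -/
  | setIdx (a c : ℕ)
  /-- `idx a := idx b + idx c` -/
  | addIdx (a b c : ℕ)
  /-- `idx a := idx b - idx c`, truncated at zero -/
  | subIdx (a b c : ℕ)
  /-- `idx a := idx (idx b)` -/
  | loadIdx (a b : ℕ)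
  /-- `idx (idx a) := idx b` -/
  | storeIdx (a b : ℕ)
  /-- `reg a := c` -/
  | setReal (a : ℕ) (c : ℝ)
  /-- `reg a := reg b + reg c` -/
  | addReal (a b c : ℕ)
  /-- `reg a := reg b - reg c` -/
  | subReal (a b c : ℕ)
  /-- `reg a := reg b * reg c` -/
  | mulReal (a b c : ℕ)
  /-- `reg a := reg b / reg c` -/
  | divReal (a b c : ℕ)
  /-- `reg a := reg (idx b)` -/
  | loadReal (a b : ℕ)
  /-- `reg (idx a) := reg b` -/
  | storeReal (a b : ℕ)
  /-- `reg a :=` coordinate `idx c` of observation `idx b` -/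
  | read (a b c : ℕ)
  /-- go to line `l` if `idx a ≤ idx b` -/
  | jumpIdx (a b l : ℕ)
  /-- go to line `l` if `reg a ≤ reg b` -/
  | jumpReal (a b l : ℕ)
  /-- stop -/
  | halt

/-- A program is a finite list of instructions. -/
abbrev Program : Type := List Instr

/-- A configuration: the current line and the contents of the registers. -/
structure Config where
  pc : ℕ
  idx : ℕ → ℕ
  reg : ℕ → ℝ

/-- The initial configuration: first line, all registers zero. -/
def Config.init : Config := ⟨0, fun _ => 0, fun _ => 0⟩

/-- Coordinate `j` of observation `i`, in the order `X₁, …, X_p, Y₁, …, Y_q` and counted from zero;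
zero when out of range. -/
def readSample {n p q : ℕ} (x : Sample n p q) (i j : ℕ) : ℝ :=
  if hi : i < n then
    if hj : j < p then x ⟨i, hi⟩ (Sum.inl ⟨j, hj⟩)
    else if hj' : j - p < q then x ⟨i, hi⟩ (Sum.inr ⟨j - p, hj'⟩)
    else 0
  else 0

open Classical in
/-- The effect of an instruction; `none` means that the machine stops. -/
def Instr.exec {n p q : ℕ} (x : Sample n p q) (s : Config) : Instr → Option Config
  | .setIdx a c => some ⟨s.pc + 1, Function.update s.idx a c, s.reg⟩
  | .addIdx a b c => some ⟨s.pc + 1, Function.update s.idx a (s.idx b + s.idx c), s.reg⟩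
  | .subIdx a b c => some ⟨s.pc + 1, Function.update s.idx a (s.idx b - s.idx c), s.reg⟩
  | .loadIdx a b => some ⟨s.pc + 1, Function.update s.idx a (s.idx (s.idx b)), s.reg⟩
  | .storeIdx a b => some ⟨s.pc + 1, Function.update s.idx (s.idx a) (s.idx b), s.reg⟩
  | .setReal a c => some ⟨s.pc + 1, s.idx, Function.update s.reg a c⟩
  | .addReal a b c => some ⟨s.pc + 1, s.idx, Function.update s.reg a (s.reg b + s.reg c)⟩
  | .subReal a b c => some ⟨s.pc + 1, s.idx, Function.update s.reg a (s.reg b - s.reg c)⟩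
  | .mulReal a b c => some ⟨s.pc + 1, s.idx, Function.update s.reg a (s.reg b * s.reg c)⟩
  | .divReal a b c => some ⟨s.pc + 1, s.idx, Function.update s.reg a (s.reg b / s.reg c)⟩
  | .loadReal a b => some ⟨s.pc + 1, s.idx, Function.update s.reg a (s.reg (s.idx b))⟩
  | .storeReal a b => some ⟨s.pc + 1, s.idx, Function.update s.reg (s.idx a) (s.reg b)⟩
  | .read a b c =>
      some ⟨s.pc + 1, s.idx, Function.update s.reg a (readSample x (s.idx b) (s.idx c))⟩
  | .jumpIdx a b l => some ⟨if s.idx a ≤ s.idx b then l else s.pc + 1, s.idx, s.reg⟩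
  | .jumpReal a b l => some ⟨if s.reg a ≤ s.reg b then l else s.pc + 1, s.idx, s.reg⟩
  | .halt => none

/-- One step; the machine also stops when the current line is beyond the end of the program. -/
def step {n p q : ℕ} (prog : Program) (x : Sample n p q) (s : Config) : Option Config :=
  prog[s.pc]?.bind (Instr.exec x s)

/-- `runFor prog x T s` is the final configuration if the machine, started at `s`, stops at one of
its first `T` steps (the step that stops is counted), and `none` otherwise. -/
def runFor {n p q : ℕ} (prog : Program) (x : Sample n p q) : ℕ → Config → Option Config
  | 0, _ => none
  | T + 1, s =>
    match step prog x s with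
    | none => some s
    | some s' => runFor prog x T s'

/-- The output list: register `idx 0` holds its length and `idx 1, idx 2, …` its entries. The
output is this list viewed as a set. -/
def Config.output (s : Config) : Finset ℕ :=
  (Finset.range (s.idx 0)).image fun k => s.idx (k + 1)

/-- `prog` computes the `{0,1}`-valued function `Φ` within `T` steps: it stops on every sample
within `T` steps, with `Φ = 1` iff register `idx 0` is nonzero. -/
def ComputesTest {n p q : ℕ} (prog : Program) (Φ : Sample n p q → Bool) (T : ℕ) : Prop :=
  ∀ x, ∃ s, runFor prog x T Config.init = some s ∧ (Φ x = true ↔ s.idx 0 ≠ 0)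

/-- `prog` computes the set-valued function `dec` within `T` steps. -/
def ComputesDecoder {n p q : ℕ} (prog : Program) (dec : Sample n p q → Finset ℕ) (T : ℕ) : Prop :=
  ∀ x, ∃ s, runFor prog x T Config.init = some s ∧ dec x = s.output

/-- A filter for the asymptotics as the sample size `n` tends to infinity inside `N`. -/
def along (N : Set ℕ) : Filter ℕ := atTop ⊓ 𝓟 N

/-- The tests `Φ n`, with `n ∈ N`, are time-`n^{t(n)}` up to a constant factor. The program may
depend on `n` (so that it may use the known parameters of the testing problem); its length is
charged along with its number of steps. -/
def IsTimeTest {p q : ℕ → ℕ} (N : Set ℕ) (t : ℕ → ℕ)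
    (Φ : ∀ n, Sample n (p n) (q n) → Bool) : Prop :=
  ∃ (prog : ℕ → Program) (K : ℕ), ∀ᶠ n in along N,
    (prog n).length ≤ K * n ^ t n ∧ ComputesTest (prog n) (Φ n) (K * n ^ t n)

/-- The set-valued decoders `dec n` are time-`n^{t(n)}`, in the same sense. -/
def IsTimeDecoder {p q : ℕ → ℕ} (t : ℕ → ℕ)
    (dec : ∀ n, Sample n (p n) (q n) → Finset ℕ) : Prop :=
  ∃ (prog : ℕ → Program) (K : ℕ), ∀ᶠ n in atTop,
    (prog n).length ≤ K * n ^ t n ∧ ComputesDecoder (prog n) (dec n) (K * n ^ t n)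

/-! ### Testing problems and the low-degree conjecture -/

/-- A sequence of simple testing problems: `H₀ : Q n` against `H₁ : P n`. -/
structure TestingSequence where
  p : ℕ → ℕ
  q : ℕ → ℕ
  P : ∀ n, Measure (Sample n (p n) (q n))
  Q : ∀ n, Measure (Sample n (p n) (q n))

/-- Along the sample sizes in `N`, both error probabilities of the tests `Φ n` tend to zero. -/
def StronglyDistinguishes (𝒮 : TestingSequence) (N : Set ℕ)
    (Φ : ∀ n, Sample n (𝒮.p n) (𝒮.q n) → Bool) : Prop :=
  Tendsto (fun n => 𝒮.Q n {x | Φ n x = true}) (along N) (𝓝 0) ∧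
    Tendsto (fun n => 𝒮.P n {x | Φ n x = false}) (along N) (𝓝 0)

/-- The low-degree conjecture for a class `Nice` of sequences of testing problems, with
polylogarithmic factor `(log n)^C`: for a nice sequence `(P_n, Q_n)`, with `n` ranging over an
infinite set `N` of sample sizes, if the low-degree norm is `O(1)` for all degrees
`D_n ≤ t(n) (log n)^C`, then no time-`n^{t(n)}` test strongly distinguishes `P_n` and `Q_n`. -/
def LowDegreeConjecture (Nice : TestingSequence → Prop) (C : ℕ) : Prop :=
  ∀ 𝒮 : TestingSequence, Nice 𝒮 → ∀ N : Set ℕ, N.Infinite →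
    (∀ᶠ n in along N, IsRegular (𝒮.P n) (𝒮.Q n)) →
    ∀ t : ℕ → ℕ, (∀ n, 1 ≤ t n) →
      (∀ D : ℕ → ℕ, (∀ᶠ n in along N, (D n : ℝ) ≤ t n * Real.log n ^ C) →
        ∃ K : ℝ, ∀ᶠ n in along N, lowDegreeNorm (𝒮.P n) (𝒮.Q n) (D n) ≤ ENNReal.ofReal K) →
      ∀ Φ : ∀ n, Sample n (𝒮.p n) (𝒮.q n) → Bool,
        IsTimeTest N t Φ → ¬ StronglyDistinguishes 𝒮 N Φ

/-- The planted mixture against the null. -/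
def plantedSequence (p q sx sy : ℕ → ℕ) (B : ℝ) : TestingSequence where
  p := p
  q := q
  P := fun n => plantedMixture n (p n) (q n) (sx n) (sy n) B
  Q := fun n => iidLaw n (nullLaw (p n) (q n))

/-- The tests `Φ n` strongly distinguish the classes `M n` of laws of one observation from the
null: the limit inferior of the sum of the type I error and of the worst type II error is zero. -/
def StronglyDistinguishesClass {p q : ℕ → ℕ} (M : ∀ n, Set (Measure (Obs (p n) (q n))))
    (Φ : ∀ n, Sample n (p n) (q n) → Bool) : Prop :=
  liminf (fun n => iidLaw n (nullLaw (p n) (q n)) {x | Φ n x = true} +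
    ⨆ μ ∈ M n, iidLaw n μ {x | Φ n x = false}) atTop = 0

/-- The supremum, over the laws in the Gaussian sparse CCA model with rank at least one and at most
`r`, of the probability that the decoders fail to recover both supports `D(U)` and `D(V)`. -/
def recoveryError {n p q : ℕ} (r sx sy : ℕ) (B : ℝ)
    (decx decy : Sample n p q → Finset ℕ) : ℝ≥0∞ :=
  ⨆ (k : ℕ) (_ : 1 ≤ k ∧ k ≤ r) (μ : Measure (Obs p q))
    (U : Matrix (Fin p) (Fin k) ℝ) (V : Matrix (Fin q) (Fin k) ℝ) (_ : InModel sx sy B μ U V),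
    iidLaw n μ {x | ¬ (decx x = (rowSupport U).image Fin.val ∧
      decy x = (rowSupport V).image Fin.val)}

/-- The decoders recover both supports with probability tending to one, uniformly over the model,
and return the empty set with probability tending to one under the null. -/
def RecoversSupport {p q : ℕ → ℕ} (r : ℕ) (sx sy : ℕ → ℕ) (B : ℝ)
    (decx decy : ∀ n, Sample n (p n) (q n) → Finset ℕ) : Prop :=
  Tendsto (fun n => recoveryError r (sx n) (sy n) B (decx n) (decy n)) atTop (𝓝 0) ∧
    Tendsto (fun n => iidLaw n (nullLaw (p n) (q n)) {x | decx n x ≠ ∅}) atTop (𝓝 0) ∧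
    Tendsto (fun n => iidLaw n (nullLaw (p n) (q n)) {x | decy n x ≠ ∅}) atTop (𝓝 0)

end SparseCCA

end

namespace SparseCCA

/-! ### Gaussian integration by parts for polynomials -/

/-! The theorem is a reduction to the conjecture plus a second moment bound. Sign vectors have norm
one, so each planted law has rank one, canonical correlation `1/B`, canonical directions `α`, `β`,
and covariance blocks `I`: it lies in the model (`inModel_plantedLaw`). The type II error under the
mixture is therefore at most the worst one over the model. If the liminf of the total error is zero,
then along an infinite set of sample sizes the test strongly distinguishes mixture and null, which
the conjecture forbids once the low-degree norm is bounded. Support recovery implies detection: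
reject when the decoded support is nonempty.

The norm is computed in the Hermite basis, which is orthogonal under the null. For one planted
observation, Gaussian integration by parts gives the mean of the Hermite product with index `γ`: it
vanishes unless the `X`-degree and the `Y`-degree agree, and for common degree `d` it is `ρ^d d! α^γ
β^γ` (`gaussianMean_spikedCov_hermiteProd`). Squaring the mean over `(α, β)` introduces an
independent copy `(α', β')`, and the multinomial theorem sums over `γ`. The bound for the squared
norm becomes the sum over `e ≤ D/2` of `C(n+e-1, e) B^(-2e) E⟨α,α'⟩^e E⟨β,β'⟩^e`
(`sum_sq_integral_hermiteProd_plantedMixture`, `sum_multiIndices_comp_sum`).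

Odd moments vanish by symmetry. For `e = 2m`, Khintchine's inequality given the supports and a
moment bound for the size of the common support yield `E⟨α,α'⟩^(2m) ≤ (2m-1)!! (1/p + m/s²)^m`
(`overlapMoment_even_le`). The assumptions on `p`, `q`, `sx`, `sy` make the base at most `B²/(4n)`,
so the `e`-th term is at most `2^(-e)` (`low_degree_term_le`) and the series is bounded. -/

lemma integrable_pow_gaussianReal (k : ℕ) :
    Integrable (fun x : ℝ => x ^ k) (gaussianReal 0 1) := by
  have h := (memLp_id_gaussianReal (μ := 0) (v := 1) k).integrable_norm_pow'
  refine h.mono' (by fun_prop) (ae_of_all _ fun x => ?_)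
  simp

lemma integrable_pow_mul_gaussianPDFReal (k : ℕ) :
    Integrable (fun x : ℝ => x ^ k * gaussianPDFReal 0 1 x) := by
  have h := integrable_pow_gaussianReal k
  rw [gaussianReal_of_var_ne_zero _ one_ne_zero, integrable_withDensity_iff_integrable_smul'
    (measurable_gaussianPDF _ _) (ae_of_all _ fun _ => gaussianPDF_lt_top)] at h
  simpa [toReal_gaussianPDF, mul_comm] using h

lemma hasDerivAt_gaussianPDFReal (x : ℝ) :
    HasDerivAt (gaussianPDFReal 0 1) (-x * gaussianPDFReal 0 1 x) x := by
  have h : HasDerivAt (fun x : ℝ => -(x - 0) ^ 2 / (2 * ((1 : NNReal) : ℝ))) (-x) x := by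
    have := (((hasDerivAt_id x).sub_const 0).pow 2).neg.div_const (2 * ((1 : NNReal) : ℝ))
    refine this.congr_deriv ?_
    simp
    ring
  have h2 := h.exp.const_mul (√(2 * Real.pi * ((1 : NNReal) : ℝ)))⁻¹
  rw [gaussianPDFReal_def]
  refine h2.congr_deriv ?_
  ring

/-- The recursion for the moments of the standard normal law. -/
lemma integral_pow_succ_gaussianReal (k : ℕ) :
    ∫ x, x ^ (k + 1) ∂gaussianReal 0 1 = k * ∫ x, x ^ (k - 1) ∂gaussianReal 0 1 := by
  -- The derivative of `x^k φ(x)` integrates to zero. At `k = 0` the truncated exponent `k - 1` is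
  -- harmless, because its factor `k` vanishes.
  have hd : ∀ x : ℝ, HasDerivAt (fun x : ℝ => x ^ k * gaussianPDFReal 0 1 x)
      (k * (x ^ (k - 1) * gaussianPDFReal 0 1 x) - x ^ (k + 1) * gaussianPDFReal 0 1 x) x := by
    intro x
    refine ((hasDerivAt_pow k x).mul (hasDerivAt_gaussianPDFReal x)).congr_deriv ?_
    ring
  have h := integral_eq_zero_of_hasDerivAt_of_integrable hd
    (((integrable_pow_mul_gaussianPDFReal (k - 1)).const_mul _).sub
      (integrable_pow_mul_gaussianPDFReal (k + 1))) (integrable_pow_mul_gaussianPDFReal k)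
  rw [integral_sub ((integrable_pow_mul_gaussianPDFReal (k - 1)).const_mul _)
      (integrable_pow_mul_gaussianPDFReal (k + 1)), integral_const_mul] at h
  rw [integral_gaussianReal_eq_integral_smul one_ne_zero,
    integral_gaussianReal_eq_integral_smul one_ne_zero]
  simp only [smul_eq_mul, mul_comm (gaussianPDFReal 0 1 _)]
  linarith

section Stein

open MvPolynomial
open scoped MatrixOrder

variable {ι : Type*} [Fintype ι]

lemma integrable_eval_pi {μ : ι → Measure ℝ} [∀ i, SigmaFinite (μ i)]
    (h : ∀ i k, Integrable (fun x : ℝ => x ^ k) (μ i)) (f : MvPolynomial ι ℝ) :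
    Integrable (fun x : ι → ℝ => eval x f) (Measure.pi μ) := by
  simp only [eval_eq']
  exact integrable_finsetSum _ fun d _ => (Integrable.fintype_prod fun i => h i (d i)).const_mul _

lemma integrable_and_integral_eval_stdGaussian (f : MvPolynomial ι ℝ) :
    Integrable (fun x : EuclideanSpace ℝ ι => eval (fun i => x i) f)
      (stdGaussian (EuclideanSpace ℝ ι)) ∧
    ∫ x : EuclideanSpace ℝ ι, eval (fun i => x i) f ∂(stdGaussian (EuclideanSpace ℝ ι)) =
      ∫ x : ι → ℝ, eval x f ∂Measure.pi fun _ => gaussianReal 0 1 := by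
  have hm : Measurable fun x : EuclideanSpace ℝ ι => eval (fun i => x i) f := by
    simp only [eval_eq']
    fun_prop
  constructor
  · rw [← map_pi_eq_stdGaussian, integrable_map_measure hm.aestronglyMeasurable (by fun_prop)]
    exact integrable_eval_pi (fun _ => integrable_pow_gaussianReal) f
  · rw [← map_pi_eq_stdGaussian, integral_map (by fun_prop) hm.aestronglyMeasurable]

/-- By linearity it suffices to treat monomials, whose integrals factor over coordinates; only
coordinate `i` changes, and there the claim is the moment recursion. -/
lemma integral_X_mul_pi_gaussianReal [DecidableEq ι] (i : ι) (f : MvPolynomial ι ℝ) :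
    ∫ x : ι → ℝ, eval x (X i * f) ∂(Measure.pi fun _ => gaussianReal 0 1) =
      ∫ x : ι → ℝ, eval x (pderiv i f) ∂(Measure.pi fun _ => gaussianReal 0 1) := by
  have hint := integrable_eval_pi (fun _ : ι => integrable_pow_gaussianReal)
  induction f using MvPolynomial.induction_on' with
  | add f g hf hg =>
    simp only [mul_add, map_add] at *
    rw [integral_add (hint _) (hint _), integral_add (hint _) (hint _), hf, hg]
  | monomial d c =>
    have e : ∀ (m : ι →₀ ℕ) (b : ℝ), ∫ x : ι → ℝ, eval x (monomial m b)
        ∂(Measure.pi fun _ => gaussianReal 0 1) = b * ∏ j, ∫ x, x ^ m j ∂gaussianReal 0 1 := by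
      intro m b
      rw [← integral_fintype_prod_eq_prod (fun j (x : ℝ) => x ^ m j), ← integral_const_mul]
      simp [eval_monomial, Finsupp.prod_fintype]
    rw [X, monomial_mul, pderiv_monomial, e, e, one_mul, mul_assoc]
    congr 1
    rw [← Finset.mul_prod_erase _ _ (Finset.mem_univ i),
      ← Finset.mul_prod_erase _ _ (Finset.mem_univ i), ← mul_assoc]
    congr 1
    · simp only [Finsupp.add_apply, Finsupp.single_eq_same, Finsupp.tsub_apply]
      rw [add_comm, integral_pow_succ_gaussianReal]
    · refine Finset.prod_congr rfl fun j hj => ?_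
      have hji : j ≠ i := Finset.ne_of_mem_erase hj
      simp [hji.symm]

/-- The chain rule for a substitution of polynomials. -/
lemma pderiv_bind_sum {κ : Type*} (l : ι → MvPolynomial κ ℝ) (k : κ) (f : MvPolynomial ι ℝ) :
    pderiv k (bind₁ l f) = ∑ j, pderiv k (l j) * bind₁ l (pderiv j f) := by
  classical
  induction f using MvPolynomial.induction_on with
  | C a => simp
  | add f g hf hg => simp [hf, hg, mul_add, Finset.sum_add_distrib]
  | mul_X f i hf =>
    simp only [map_mul, bind₁_X_right, Derivation.leibniz, smul_eq_mul, hf, map_add, mul_add,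
      Finset.sum_add_distrib, pderiv_X, Pi.single_apply]
    rw [Finset.mul_sum]
    congr 1
    · simp [apply_ite, mul_comm]
    · refine Finset.sum_congr rfl fun j _ => by ring

/-- Integration by parts after the linear substitution `x ↦ a x`: the chain rule produces the
entries of the covariance `a aᵀ`. -/
lemma integral_X_mul_bind_pi_gaussianReal [DecidableEq ι] (a : ι → ι → ℝ) (i : ι)
    (f : MvPolynomial ι ℝ) :
    ∫ x : ι → ℝ, eval x (bind₁ (fun j => ∑ k, C (a j k) * X k) (X i * f))
        ∂(Measure.pi fun _ => gaussianReal 0 1) =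
      ∑ j, (∑ k, a i k * a j k) * ∫ x : ι → ℝ, eval x
        (bind₁ (fun j => ∑ k, C (a j k) * X k) (pderiv j f))
        ∂(Measure.pi fun _ => gaussianReal 0 1) := by
  have hint := integrable_eval_pi (fun _ : ι => integrable_pow_gaussianReal)
  have h1 : ∀ x : ι → ℝ, eval x (bind₁ (fun j => ∑ k, C (a j k) * X k) (X i * f)) =
      ∑ k, a i k * eval x (X k * bind₁ (fun j => ∑ k, C (a j k) * X k) f) := by
    intro x
    simp [Finset.sum_mul, mul_assoc]
  have h2 : ∀ k j, pderiv k (∑ l, C (a j l) * X l : MvPolynomial ι ℝ) = C (a j k) := by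
    intro k j
    simp [pderiv_X, Pi.single_apply]
  simp_rw [h1]
  rw [integral_finsetSum _ fun k _ => (hint _).const_mul _]
  simp_rw [integral_const_mul, integral_X_mul_pi_gaussianReal, pderiv_bind_sum, h2, map_sum,
    integral_finsetSum _ fun k _ => hint _, map_mul, eval_C, integral_const_mul,
    Finset.mul_sum, Finset.sum_mul]
  rw [Finset.sum_comm]
  exact Finset.sum_congr rfl fun j _ => Finset.sum_congr rfl fun k _ => by rw [mul_assoc]

/-- The mean of a polynomial under the centered Gaussian law with covariance matrix `S`. -/
noncomputable def gaussianMean [DecidableEq ι] (S : Matrix ι ι ℝ) (f : MvPolynomial ι ℝ) : ℝ :=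
  ∫ x : EuclideanSpace ℝ ι, eval (fun i => x i) f ∂(multivariateGaussian 0 S)

variable [DecidableEq ι] (S : Matrix ι ι ℝ)

/-- The Gaussian law is by definition the image of the standard one under `CFC.sqrt S`. Hence this
holds for every matrix `S`; positivity matters only when the root is squared back to `S`. -/
lemma integrable_and_gaussianMean_eq (f : MvPolynomial ι ℝ) :
    Integrable (fun x : EuclideanSpace ℝ ι => eval (fun i => x i) f) (multivariateGaussian 0 S) ∧
    gaussianMean S f = ∫ x : ι → ℝ, eval x (bind₁ (fun i => ∑ j, C (CFC.sqrt S i j) * X j) f)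
      ∂Measure.pi fun _ => gaussianReal 0 1 := by
  have hm : Measurable fun x : EuclideanSpace ℝ ι => eval (fun i => x i) f := by
    simp only [eval_eq']
    fun_prop
  have he : ∀ x : EuclideanSpace ℝ ι,
      eval (fun i => (0 + toEuclideanCLM (𝕜 := ℝ) (CFC.sqrt S) x) i) f =
        eval (fun i => x i) (bind₁ (fun i => ∑ j, C (CFC.sqrt S i j) * X j) f) := by
    intro x
    rw [← aeval_eq_eval, ← aeval_eq_eval, aeval_bind₁]
    congr 2
    ext i
    simp [ofLp_toEuclideanCLM, Matrix.mulVec, dotProduct]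
  have h := integrable_and_integral_eval_stdGaussian (bind₁ (fun i => ∑ j, C (CFC.sqrt S i j) * X j) f)
  constructor
  · rw [multivariateGaussian, integrable_map_measure hm.aestronglyMeasurable (by fun_prop)]
    simpa only [Function.comp_def, he] using h.1
  · rw [gaussianMean, multivariateGaussian, integral_map (by fun_prop) hm.aestronglyMeasurable]
    simpa only [he] using h.2

lemma integrable_eval_multivariateGaussian (f : MvPolynomial ι ℝ) :
    Integrable (fun x : EuclideanSpace ℝ ι => eval (fun i => x i) f) (multivariateGaussian 0 S) :=
  (integrable_and_gaussianMean_eq S f).1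

lemma gaussianMean_one : gaussianMean S 1 = 1 := by
  simp [gaussianMean]

lemma gaussianMean_add (f g : MvPolynomial ι ℝ) :
    gaussianMean S (f + g) = gaussianMean S f + gaussianMean S g := by
  simp only [gaussianMean, map_add]
  exact integral_add (integrable_eval_multivariateGaussian S f)
    (integrable_eval_multivariateGaussian S g)

lemma gaussianMean_C_mul (c : ℝ) (f : MvPolynomial ι ℝ) :
    gaussianMean S (C c * f) = c * gaussianMean S f := by
  simp only [gaussianMean, map_mul, eval_C, integral_const_mul]

lemma gaussianMean_sub (f g : MvPolynomial ι ℝ) :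
    gaussianMean S (f - g) = gaussianMean S f - gaussianMean S g := by
  have h := gaussianMean_add S (f - g) g
  rw [sub_add_cancel] at h
  linarith

lemma gaussianMean_zero : gaussianMean S 0 = 0 := by
  simp [gaussianMean]

variable {S}

/-- Gaussian integration by parts. -/
lemma gaussianMean_X_mul (hS : S.PosSemidef) (i : ι) (f : MvPolynomial ι ℝ) :
    gaussianMean S (X i * f) = ∑ j, S i j * gaussianMean S (pderiv j f) := by
  have hsq : CFC.sqrt S * CFC.sqrt S = S := by
    exact CFC.sqrt_mul_sqrt_self S hS.nonneg
  have hsym : ∀ j k, CFC.sqrt S j k = CFC.sqrt S k j := by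
    intro j k
    have := congrFun (congrFun (CFC.sqrt_nonneg S).isSelfAdjoint.star_eq k) j
    simpa [star_apply] using this
  have h3 : ∀ j, S i j = ∑ k, CFC.sqrt S i k * CFC.sqrt S j k := by
    intro j
    simp_rw [hsym j]
    rw [← Matrix.mul_apply, hsq]
  simp only [(integrable_and_gaussianMean_eq S _).2, h3]
  exact integral_X_mul_bind_pi_gaussianReal (fun j k => CFC.sqrt S j k) i f

end Stein

/-! ### Hermite polynomials in several variables -/

section Hermite

open MvPolynomial

lemma derivative_hermite (n : ℕ) :
    Polynomial.derivative (Polynomial.hermite n) = n * Polynomial.hermite (n - 1) := by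
  induction n with
  | zero => simp
  | succ n ih =>
    rw [Polynomial.hermite_succ, Polynomial.derivative_sub, Polynomial.derivative_mul, ih,
      Polynomial.derivative_X, Polynomial.derivative_mul, Polynomial.derivative_natCast]
    cases n with
    | zero => simp
    | succ n =>
      rw [Nat.add_sub_cancel, Nat.add_sub_cancel, Polynomial.hermite_succ n]
      push_cast
      ring

variable {ι : Type*}

/-- The Hermite polynomial of degree `k` in the variable `i`. -/
noncomputable def hermiteVar (i : ι) (k : ℕ) : MvPolynomial ι ℝ :=
  Polynomial.aeval (X i) ((Polynomial.hermite k).map (Int.castRingHom ℝ))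

lemma pderiv_hermiteVar_self (i : ι) (k : ℕ) :
    pderiv i (hermiteVar i k) = C (k : ℝ) * hermiteVar i (k - 1) := by
  rw [hermiteVar, Derivation.map_aeval, pderiv_X_self, Polynomial.derivative_map,
    derivative_hermite]
  simp [hermiteVar]

lemma pderiv_hermiteVar_of_ne {i j : ι} (h : j ≠ i) (k : ℕ) : pderiv i (hermiteVar j k) = 0 := by
  rw [hermiteVar, Derivation.map_aeval, pderiv_X_of_ne h, smul_zero]

lemma hermiteVar_zero (i : ι) : hermiteVar i 0 = 1 := by
  simp [hermiteVar]

lemma hermiteVar_succ (i : ι) (k : ℕ) :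
    hermiteVar i (k + 1) = X i * hermiteVar i k - pderiv i (hermiteVar i k) := by
  conv_lhs => rw [hermiteVar, Polynomial.hermite_succ]
  rw [hermiteVar, Derivation.map_aeval, pderiv_X_self, Polynomial.derivative_map]
  simp

variable [Fintype ι]

/-- The product of the Hermite polynomials of degrees `γ i` in the variables `i`. -/
noncomputable def hermiteProd (γ : ι → ℕ) : MvPolynomial ι ℝ := ∏ i, hermiteVar i (γ i)

lemma hermiteProd_zero : hermiteProd (0 : ι → ℕ) = 1 := by
  simp [hermiteProd, hermiteVar_zero]

variable [DecidableEq ι]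

lemma hermiteProd_update (γ : ι → ℕ) (i : ι) (k : ℕ) :
    hermiteProd (Function.update γ i k) =
      hermiteVar i k * ∏ j ∈ Finset.univ.erase i, hermiteVar j (γ j) := by
  rw [hermiteProd, ← Finset.mul_prod_erase _ _ (Finset.mem_univ i), Function.update_self]
  congr 1
  refine Finset.prod_congr rfl fun j hj => ?_
  rw [Function.update_of_ne (Finset.ne_of_mem_erase hj)]

lemma pderiv_prod_erase (γ : ι → ℕ) (i : ι) :
    pderiv i (∏ j ∈ Finset.univ.erase i, hermiteVar j (γ j)) = 0 := by
  refine Finset.prod_induction _ (fun f => pderiv i f = 0) ?_ ?_ ?_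
  · intro f g hf hg
    simp [Derivation.leibniz, hf, hg]
  · simp
  · exact fun j hj => pderiv_hermiteVar_of_ne (Finset.ne_of_mem_erase hj) _

lemma pderiv_hermiteProd (γ : ι → ℕ) (i : ι) :
    pderiv i (hermiteProd γ) =
      C (γ i : ℝ) * hermiteProd (Function.update γ i (γ i - 1)) := by
  conv_lhs => rw [← Function.update_eq_self i γ]
  rw [hermiteProd_update, hermiteProd_update, Derivation.leibniz, pderiv_prod_erase,
    pderiv_hermiteVar_self]
  simp only [smul_eq_mul]
  ring

lemma hermiteProd_succ (γ : ι → ℕ) (i : ι) :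
    hermiteProd (Function.update γ i (γ i + 1)) =
      X i * hermiteProd γ - pderiv i (hermiteProd γ) := by
  conv_rhs => rw [← Function.update_eq_self i γ]
  rw [hermiteProd_update, hermiteProd_update, Derivation.leibniz, pderiv_prod_erase,
    hermiteVar_succ]
  simp only [smul_eq_mul]
  ring

/-- Raising an index is `X i * h - ∂ᵢ h`, and the factor `X i` is integrated by parts. When `S i i =
1`, the subtracted term cancels against part of the summand `j = i`; this is why Hermite polynomials
suit covariances with unit diagonal. -/
lemma gaussianMean_hermiteProd_succ_mul {S : Matrix ι ι ℝ} (hS : S.PosSemidef) (γ : ι → ℕ) (i : ι)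
    (g : MvPolynomial ι ℝ) :
    gaussianMean S (hermiteProd (Function.update γ i (γ i + 1)) * g) =
      ∑ j, S i j * gaussianMean S (pderiv j (hermiteProd γ * g)) -
        gaussianMean S (pderiv i (hermiteProd γ) * g) := by
  rw [hermiteProd_succ, sub_mul, gaussianMean_sub, mul_assoc, gaussianMean_X_mul hS]

/-- Under the standard law, raising in coordinate `i` is adjoint to `∂ᵢ`. -/
lemma gaussianMean_one_hermiteProd_succ_mul (γ : ι → ℕ) (i : ι) (g : MvPolynomial ι ℝ) :
    gaussianMean (1 : Matrix ι ι ℝ) (hermiteProd (Function.update γ i (γ i + 1)) * g) =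
      gaussianMean (1 : Matrix ι ι ℝ) (hermiteProd γ * pderiv i g) := by
  rw [gaussianMean_hermiteProd_succ_mul PosSemidef.one]
  simp only [one_apply, ite_mul, one_mul, zero_mul, Finset.sum_ite_eq, Finset.mem_univ, if_true]
  rw [← gaussianMean_sub, Derivation.leibniz]
  simp only [smul_eq_mul]
  congr 1
  ring

/-- A nonzero multi-index is the successor of another one in some coordinate. -/
lemma exists_eq_update_succ {γ : ι → ℕ} {i : ι} (h : γ i ≠ 0) :
    ∃ γ' : ι → ℕ, γ = Function.update γ' i (γ' i + 1) ∧ ∑ j, γ j = ∑ j, γ' j + 1 := by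
  have h1 : γ = Function.update (Function.update γ i (γ i - 1)) i
      (Function.update γ i (γ i - 1) i + 1) := by
    simp [Nat.sub_add_cancel (Nat.one_le_iff_ne_zero.2 h)]
  refine ⟨Function.update γ i (γ i - 1), h1, ?_⟩
  rw [← Finset.add_sum_erase _ _ (Finset.mem_univ i), ← Finset.add_sum_erase _ _
    (Finset.mem_univ i), Function.update_self]
  have : ∑ x ∈ Finset.univ.erase i, Function.update γ i (γ i - 1) x =
      ∑ x ∈ Finset.univ.erase i, γ x := Finset.sum_congr rfl fun j hj => by
    rw [Function.update_of_ne (Finset.ne_of_mem_erase hj)]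
  rw [this]
  omega

lemma prod_factorial_update_succ (γ : ι → ℕ) (i : ι) :
    (∏ j, ((Function.update γ i (γ i + 1) j).factorial : ℝ)) =
      (γ i + 1) * ∏ j, ((γ j).factorial : ℝ) := by
  rw [← Finset.mul_prod_erase _ _ (Finset.mem_univ i), ← Finset.mul_prod_erase _ _
    (Finset.mem_univ i), Function.update_self, Nat.factorial_succ, ← mul_assoc]
  push_cast
  congr 1
  refine Finset.prod_congr rfl fun j hj => ?_
  rw [Function.update_of_ne (Finset.ne_of_mem_erase hj)]

/-- The Hermite polynomials are orthogonal for the standard Gaussian law. -/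
lemma gaussianMean_one_hermiteProd_mul (γ δ : ι → ℕ) :
    gaussianMean (1 : Matrix ι ι ℝ) (hermiteProd γ * hermiteProd δ) =
      if γ = δ then ∏ i, ((γ i).factorial : ℝ) else 0 := by
  -- Each step moves one raising operator from `γ` onto `δ` as a derivative, which lowers both
  -- indices in the same coordinate.
  induction hk : ∑ j, γ j generalizing γ δ with
  | zero =>
    have hγ : γ = 0 := by
      ext i
      exact (Finset.sum_eq_zero_iff.1 hk) i (Finset.mem_univ i)
    subst hγ
    rw [hermiteProd_zero, one_mul]
    by_cases hδ : δ = 0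
    · subst hδ
      simp [hermiteProd_zero, gaussianMean_one]
    · rw [if_neg (Ne.symm hδ)]
      obtain ⟨i, hi⟩ := Function.ne_iff.1 hδ
      obtain ⟨δ', rfl, -⟩ := exists_eq_update_succ hi
      rw [← mul_one (hermiteProd _), gaussianMean_one_hermiteProd_succ_mul]
      simp [gaussianMean_zero]
  | succ k ih =>
    obtain ⟨i, hi⟩ : ∃ i, γ i ≠ 0 := by
      by_contra! h
      simp [h] at hk
    obtain ⟨γ', rfl, hγ'⟩ := exists_eq_update_succ hi
    rw [gaussianMean_one_hermiteProd_succ_mul, pderiv_hermiteProd, mul_left_comm,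
      gaussianMean_C_mul, ih _ _ (by omega)]
    by_cases hδ : δ i = 0
    · have h2 : Function.update γ' i (γ' i + 1) ≠ δ := by
        rintro rfl
        exact hi hδ
      rw [hδ, if_neg h2]
      simp
    · obtain ⟨δ', rfl, -⟩ := exists_eq_update_succ hδ
      have h1 : Function.update (Function.update δ' i (δ' i + 1)) i
          (Function.update δ' i (δ' i + 1) i - 1) = δ' := by simp
      rw [h1, prod_factorial_update_succ, Function.update_self]
      by_cases h : γ' = δ'
      · subst h
        simp
      · have h2 : Function.update γ' i (γ' i + 1) ≠ Function.update δ' i (δ' i + 1) := by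
          intro h2
          apply h
          ext j
          have h3 := congrFun h2 j
          rcases eq_or_ne j i with rfl | hj
          · simpa using h3
          · simpa [hj] using h3
        rw [if_neg h, if_neg h2, mul_zero]

/-- The multi-indices of degree at most `D`. -/
noncomputable def multiIndices (ι : Type*) [Fintype ι] [DecidableEq ι] (D : ℕ) : Finset (ι → ℕ) :=
  (Fintype.piFinset fun _ => Finset.range (D + 1)).filter fun γ => ∑ i, γ i ≤ D

lemma mem_multiIndices {D : ℕ} {γ : ι → ℕ} :
    γ ∈ multiIndices ι D ↔ ∑ i, γ i ≤ D := by
  simp only [multiIndices, Finset.mem_filter, Fintype.mem_piFinset, Finset.mem_range,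
    and_iff_right_iff_imp]
  intro h i
  exact Nat.lt_succ_of_le ((Finset.single_le_sum (fun _ _ => Nat.zero_le _)
    (Finset.mem_univ i)).trans h)

/-- Three-term recurrence: `X i` times a Hermite product is the product raised in `i` plus `γ i`
times the product lowered in `i`. -/
lemma X_mul_mem_span_hermiteProd {D : ℕ} (i : ι) {f : MvPolynomial ι ℝ}
    (hf : f ∈ Submodule.span ℝ (hermiteProd '' (multiIndices ι D : Set (ι → ℕ)))) :
    X i * f ∈ Submodule.span ℝ (hermiteProd '' (multiIndices ι (D + 1) : Set (ι → ℕ))) := by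
  induction hf using Submodule.span_induction with
  | zero => simp
  | add f g _ _ hf hg =>
    rw [mul_add]
    exact add_mem hf hg
  | smul c f _ hf =>
    rw [mul_smul_comm]
    exact Submodule.smul_mem _ _ hf
  | mem f hf =>
    obtain ⟨γ, hγ, rfl⟩ := hf
    have hγ' := mem_multiIndices.1 (Finset.mem_coe.1 hγ)
    have h := hermiteProd_succ γ i
    rw [pderiv_hermiteProd] at h
    rw [sub_eq_iff_eq_add.1 h.symm]
    rw [← smul_eq_C_mul]
    have hs : ∀ m, ∑ j, Function.update γ i m j + γ i = ∑ j, γ j + m := by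
      intro m
      rw [Finset.sum_update_of_mem (Finset.mem_univ i), ← Finset.add_sum_erase _ _
        (Finset.mem_univ i), Finset.sdiff_singleton_eq_erase]
      omega
    refine add_mem (Submodule.subset_span ⟨_, ?_, rfl⟩)
      (Submodule.smul_mem _ _ (Submodule.subset_span ⟨_, ?_, rfl⟩))
    · rw [Finset.mem_coe, mem_multiIndices]
      have := hs (γ i + 1)
      omega
    · rw [Finset.mem_coe, mem_multiIndices]
      have := hs (γ i - 1)
      omega

lemma monomial_mem_span_hermiteProd (D : ℕ) (d : ι →₀ ℕ) (hd : ∑ i, d i ≤ D) :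
    monomial d (1 : ℝ) ∈
      Submodule.span ℝ (hermiteProd '' (multiIndices ι D : Set (ι → ℕ))) := by
  induction D generalizing d with
  | zero =>
    have hd0 : d = 0 := by
      ext i
      exact (Finset.sum_eq_zero_iff.1 (Nat.le_zero.1 hd)) i (Finset.mem_univ i)
    subst hd0
    refine Submodule.subset_span ⟨0, ?_, ?_⟩
    · simp [mem_multiIndices]
    · rw [hermiteProd_zero]
      rfl
  | succ D ih =>
    by_cases hd0 : d = 0
    · subst hd0
      refine Submodule.subset_span ⟨0, ?_, ?_⟩
      · simp [mem_multiIndices]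
      · rw [hermiteProd_zero]
        rfl
    · obtain ⟨i, hi⟩ : ∃ i, d i ≠ 0 := by
        by_contra! h
        exact hd0 (Finsupp.ext h)
      have hle : Finsupp.single i 1 ≤ d := by
        rw [Finsupp.single_le_iff]
        omega
      have h1 : monomial d (1 : ℝ) = X i * monomial (d - Finsupp.single i 1) 1 := by
        rw [X, monomial_mul, one_mul, add_tsub_cancel_of_le hle]
      rw [h1]
      refine X_mul_mem_span_hermiteProd i (ih _ ?_)
      have h2 : ∑ j, d j = ∑ j, (d - Finsupp.single i 1 : ι →₀ ℕ) j + 1 := by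
        conv_lhs => rw [← tsub_add_cancel_of_le hle]
        simp only [Finsupp.add_apply, Finset.sum_add_distrib]
        simp [Finsupp.single_apply]
      omega

/-- A polynomial of degree at most `D` is a combination of Hermite polynomials of degree at most
`D`. -/
lemma exists_eq_sum_hermiteProd {D : ℕ} {f : MvPolynomial ι ℝ} (hf : f.totalDegree ≤ D) :
    ∃ c : (ι → ℕ) → ℝ, f = ∑ γ ∈ multiIndices ι D, C (c γ) * hermiteProd γ := by
  have hmem : f ∈ Submodule.span ℝ (hermiteProd '' (multiIndices ι D : Set (ι → ℕ))) := by
    rw [f.as_sum]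
    refine Submodule.sum_mem _ fun d hd => ?_
    rw [← mul_one (coeff d f), ← smul_eq_mul, ← smul_monomial]
    refine Submodule.smul_mem _ _ (monomial_mem_span_hermiteProd D d ?_)
    have := (le_totalDegree hd).trans hf
    rwa [Finsupp.sum_fintype _ _ (fun _ => rfl)] at this
  obtain ⟨c, hc⟩ := (Submodule.mem_span_image_finset_iff_exists_fun ℝ).1 hmem
  refine ⟨fun γ => if h : γ ∈ multiIndices ι D then c ⟨γ, h⟩ else 0, ?_⟩
  rw [← hc, ← Finset.sum_coe_sort (multiIndices ι D)]
  simp [smul_eq_C_mul]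

end Hermite

/-! ### Means of Hermite polynomials under the spiked law -/

section Spiked

variable {p q : ℕ} {a : Fin p → ℝ} {b : Fin q → ℝ} {ρ : ℝ}

/-- The mean of the Hermite polynomial of index `γ` under the spiked law. -/
noncomputable def spikedCoeff (a : Fin p → ℝ) (b : Fin q → ℝ) (ρ : ℝ) (γ : Fin p ⊕ Fin q → ℕ) : ℝ :=
  if ∑ i, γ (Sum.inl i) = ∑ j, γ (Sum.inr j) then
    ρ ^ (∑ i, γ (Sum.inl i)) * (∑ i, γ (Sum.inl i)).factorial *
      ((∏ i, a i ^ γ (Sum.inl i)) * ∏ j, b j ^ γ (Sum.inr j))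
  else 0

/-- The `X`-block is the identity, so the terms inside it cancel with the correction in the Hermite
recursion. Only the cross-covariances `ρ a_i b_j` remain: one `X`-variable is contracted with one
`Y`-variable. -/
lemma gaussianMean_spikedCov_succ_inl (hS : (spikedCov a b ρ).PosSemidef)
    (γ : Fin p ⊕ Fin q → ℕ) (i : Fin p) :
    gaussianMean (spikedCov a b ρ)
        (hermiteProd (Function.update γ (Sum.inl i) (γ (Sum.inl i) + 1))) =
      ∑ j, ρ * (a i * b j) * (γ (Sum.inr j) * gaussianMean (spikedCov a b ρ)
        (hermiteProd (Function.update γ (Sum.inr j) (γ (Sum.inr j) - 1)))) := by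
  rw [← mul_one (hermiteProd _), gaussianMean_hermiteProd_succ_mul hS, Fintype.sum_sum_type]
  simp_rw [mul_one, pderiv_hermiteProd, gaussianMean_C_mul]
  simp [spikedCov, one_apply, vecMulVec_apply]

lemma gaussianMean_spikedCov_succ_inr (hS : (spikedCov a b ρ).PosSemidef)
    (γ : Fin p ⊕ Fin q → ℕ) (j : Fin q) :
    gaussianMean (spikedCov a b ρ)
        (hermiteProd (Function.update γ (Sum.inr j) (γ (Sum.inr j) + 1))) =
      ∑ i, ρ * (b j * a i) * (γ (Sum.inl i) * gaussianMean (spikedCov a b ρ)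
        (hermiteProd (Function.update γ (Sum.inl i) (γ (Sum.inl i) - 1)))) := by
  rw [← mul_one (hermiteProd _), gaussianMean_hermiteProd_succ_mul hS, Fintype.sum_sum_type]
  simp_rw [mul_one, pderiv_hermiteProd, gaussianMean_C_mul]
  simp [spikedCov, one_apply, vecMulVec_apply]

lemma prod_pow_update_succ {m : ℕ} (c : Fin m → ℝ) (γ : Fin m → ℕ) (i : Fin m) :
    ∏ j, c j ^ Function.update γ i (γ i + 1) j = c i * ∏ j, c j ^ γ j := by
  rw [← Finset.mul_prod_erase _ _ (Finset.mem_univ i), ← Finset.mul_prod_erase _ _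
    (Finset.mem_univ i), Function.update_self, pow_succ', mul_assoc]
  congr 2
  refine Finset.prod_congr rfl fun j hj => ?_
  rw [Function.update_of_ne (Finset.ne_of_mem_erase hj)]

lemma gaussianMean_spikedCov_hermiteProd (hS : (spikedCov a b ρ).PosSemidef)
    (γ : Fin p ⊕ Fin q → ℕ) :
    gaussianMean (spikedCov a b ρ) (hermiteProd γ) = spikedCoeff a b ρ γ := by
  induction hk : ∑ i, γ (Sum.inl i) generalizing γ with
  | zero =>
    have h0 : ∀ i, γ (Sum.inl i) = 0 := fun i =>
      Finset.sum_eq_zero_iff.1 hk i (Finset.mem_univ i)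
    by_cases hγ : ∑ j, γ (Sum.inr j) = 0
    · have h1 : ∀ j, γ (Sum.inr j) = 0 := fun j =>
        Finset.sum_eq_zero_iff.1 hγ j (Finset.mem_univ j)
      have h2 : γ = 0 := by
        ext (i | j)
        · exact h0 i
        · exact h1 j
      subst h2
      simp [spikedCoeff, hermiteProd_zero, gaussianMean_one]
    · obtain ⟨j, hj⟩ : ∃ j, γ (Sum.inr j) ≠ 0 := by
        by_contra! h
        exact hγ (Finset.sum_eq_zero fun j _ => h j)
      obtain ⟨γ', rfl, -⟩ := exists_eq_update_succ hj
      rw [gaussianMean_spikedCov_succ_inr hS, spikedCoeff, hk, if_neg (Ne.symm hγ)]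
      refine Finset.sum_eq_zero fun i _ => ?_
      have := h0 i
      rw [Function.update_of_ne Sum.inl_ne_inr] at this
      simp [this]
  | succ k ih =>
    obtain ⟨i, hi⟩ : ∃ i, γ (Sum.inl i) ≠ 0 := by
      by_contra! h
      simp [h] at hk
    obtain ⟨γ', rfl, -⟩ := exists_eq_update_succ hi
    have hinl : ∀ (δ : Fin p ⊕ Fin q → ℕ) i m l, Function.update δ (Sum.inl i) m (Sum.inl l) =
        Function.update (fun l => δ (Sum.inl l)) i m l := fun δ i m l => by
      simp [Function.update_apply]
    have hinr : ∀ (δ : Fin p ⊕ Fin q → ℕ) j m l, Function.update δ (Sum.inr j) m (Sum.inr l) =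
        Function.update (fun l => δ (Sum.inr l)) j m l := fun δ j m l => by
      simp [Function.update_apply]
    have hsum : ∀ {m : ℕ} (δ : Fin m → ℕ) (l : Fin m),
        ∑ j, Function.update δ l (δ l + 1) j = ∑ j, δ j + 1 := by
      intro m δ l
      rw [Finset.sum_update_of_mem (Finset.mem_univ l), ← Finset.add_sum_erase _ δ
        (Finset.mem_univ l), Finset.sdiff_singleton_eq_erase]
      omega
    have hk' : ∑ l, γ' (Sum.inl l) = k := by
      simp only [hinl] at hk
      rw [hsum (fun l => γ' (Sum.inl l))] at hk
      omega
    -- Each summand is `γ' (Sum.inr j)` times a factor independent of `j`. The sum of these weights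
    -- is `k + 1`, which turns `k!` into `(k + 1)!`.
    have key : ∀ j, ρ * (a i * b j) * (γ' (Sum.inr j) * gaussianMean (spikedCov a b ρ)
        (hermiteProd (Function.update γ' (Sum.inr j) (γ' (Sum.inr j) - 1)))) =
        γ' (Sum.inr j) * (if k + 1 = ∑ j, γ' (Sum.inr j) then ρ ^ (k + 1) * k.factorial *
          ((a i * ∏ i, a i ^ γ' (Sum.inl i)) * ∏ j, b j ^ γ' (Sum.inr j)) else 0) := by
      intro j
      by_cases hj : γ' (Sum.inr j) = 0
      · simp [hj]
      · obtain ⟨δ, rfl, -⟩ := exists_eq_update_succ hj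
        rw [Function.update_self, Nat.add_sub_cancel, Function.update_idem,
          Function.update_eq_self, ih δ (by simpa using hk')]
        have hδ : ∑ l, δ (Sum.inl l) = k := by simpa using hk'
        simp only [spikedCoeff, hinr, hδ, Function.update_of_ne Sum.inl_ne_inr]
        rw [hsum (fun l => δ (Sum.inr l)), prod_pow_update_succ b (fun l => δ (Sum.inr l))]
        simp only [Nat.add_right_cancel_iff]
        split_ifs
        · ring
        · simp
    rw [gaussianMean_spikedCov_succ_inl hS, Finset.sum_congr rfl fun j _ => key j,
      ← Finset.sum_mul, spikedCoeff, hk]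
    simp only [hinl, Function.update_of_ne Sum.inr_ne_inl]
    rw [prod_pow_update_succ a (fun l => γ' (Sum.inl l))]
    split_ifs with h
    · rw [← Nat.cast_sum, ← h, Nat.factorial_succ]
      push_cast
      ring
    · simp

lemma dotProduct_spikedCov_mulVec (w : Fin p ⊕ Fin q → ℝ) :
    w ⬝ᵥ (spikedCov a b ρ *ᵥ w) = ∑ i, w (Sum.inl i) ^ 2 + ∑ j, w (Sum.inr j) ^ 2 +
      2 * ρ * ((∑ i, a i * w (Sum.inl i)) * ∑ j, b j * w (Sum.inr j)) := by
  have h1 : ∀ i, (spikedCov a b ρ *ᵥ w) (Sum.inl i) =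
      w (Sum.inl i) + ρ * a i * ∑ j, b j * w (Sum.inr j) := by
    intro i
    simp [spikedCov, Matrix.mulVec, dotProduct, one_apply, vecMulVec_apply, Finset.mul_sum,
      mul_assoc]
  have h2 : ∀ j, (spikedCov a b ρ *ᵥ w) (Sum.inr j) =
      w (Sum.inr j) + ρ * b j * ∑ i, a i * w (Sum.inl i) := by
    intro i
    simp [spikedCov, Matrix.mulVec, dotProduct, one_apply, vecMulVec_apply, Finset.mul_sum,
      mul_assoc, add_comm]
  rw [dotProduct, Fintype.sum_sum_type]
  simp only [h1, h2, mul_add, Finset.sum_add_distrib, ← pow_two]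
  have h3 : ∑ i, w (Sum.inl i) * (ρ * a i * ∑ j, b j * w (Sum.inr j)) =
      ρ * ((∑ i, a i * w (Sum.inl i)) * ∑ j, b j * w (Sum.inr j)) := by
    rw [Finset.sum_mul, Finset.mul_sum]
    exact Finset.sum_congr rfl fun _ _ => by ring
  have h4 : ∑ j, w (Sum.inr j) * (ρ * b j * ∑ i, a i * w (Sum.inl i)) =
      ρ * ((∑ i, a i * w (Sum.inl i)) * ∑ j, b j * w (Sum.inr j)) := by
    rw [mul_comm (∑ i, a i * w (Sum.inl i)), Finset.sum_mul, Finset.mul_sum]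
    exact Finset.sum_congr rfl fun _ _ => by ring
  rw [h3, h4]
  ring

lemma posDef_spikedCov (ha : ∑ i, a i ^ 2 = 1) (hb : ∑ j, b j ^ 2 = 1) (h0 : 0 ≤ ρ) (h1 : ρ < 1) :
    (spikedCov a b ρ).PosDef := by
  refine PosDef.of_dotProduct_mulVec_pos ?_ ?_
  · rw [IsHermitian, conjTranspose_eq_transpose_of_trivial, spikedCov, fromBlocks_transpose]
    simp [transpose_vecMulVec]
  · intro w hw
    rw [star_trivial, dotProduct_spikedCov_mulVec]
    have hx := Finset.sum_mul_sq_le_sq_mul_sq Finset.univ a fun i => w (Sum.inl i)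
    have hy := Finset.sum_mul_sq_le_sq_mul_sq Finset.univ b fun j => w (Sum.inr j)
    rw [ha, one_mul] at hx
    rw [hb, one_mul] at hy
    have hpos : 0 < ∑ i, w (Sum.inl i) ^ 2 + ∑ j, w (Sum.inr j) ^ 2 := by
      rw [← Fintype.sum_sum_type fun s => w s ^ 2]
      obtain ⟨s, hs⟩ := Function.ne_iff.1 hw
      exact Finset.sum_pos' (fun _ _ => sq_nonneg _)
        ⟨s, Finset.mem_univ _, by have : w s ≠ 0 := hs; positivity⟩
    -- With `u = ⟨a, x⟩` and `v = ⟨b, y⟩`, `2ρuv ≥ -ρ(u² + v²) ≥ -ρ(|x|² + |y|²)`, and `ρ < 1`.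
    nlinarith [mul_nonneg h0 (sq_nonneg ((∑ i, a i * w (Sum.inl i)) + ∑ j, b j * w (Sum.inr j)))]

end Spiked

/-! ### Polynomials of a sample of Gaussian observations -/

section Samples

open MvPolynomial

variable {n p q : ℕ}

instance isProbabilityMeasure_nullLaw : IsProbabilityMeasure (nullLaw p q) := by
  rw [nullLaw]
  infer_instance

lemma eval_hermiteVar {ι : Type*} (x : ι → ℝ) (i : ι) (k : ℕ) :
    eval x (hermiteVar i k) =
      ((Polynomial.hermite k).map (Int.castRingHom ℝ)).eval (x i) := by
  rw [hermiteVar, ← aeval_eq_eval, ← Polynomial.aeval_algHom_apply, aeval_X,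
    Polynomial.coe_aeval_eq_eval]

lemma evalPoly_hermiteProd (γ : Fin n × (Fin p ⊕ Fin q) → ℕ) (x : Sample n p q) :
    evalPoly (hermiteProd γ) x =
      ∏ k, eval (fun i => x k i) (hermiteProd fun i => γ (k, i)) := by
  simp only [evalPoly, hermiteProd, map_prod, eval_hermiteVar]
  rw [Fintype.prod_prod_type]

lemma integrable_evalPoly_iidLaw (S : Matrix (Fin p ⊕ Fin q) (Fin p ⊕ Fin q) ℝ)
    (f : MvPolynomial (Fin n × (Fin p ⊕ Fin q)) ℝ) :
    Integrable (evalPoly f) (iidLaw n (multivariateGaussian 0 S)) := by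
  have h : evalPoly f = fun x : Sample n p q => ∑ d ∈ f.support, coeff d f *
      ∏ k, eval (fun i => x k i) (∏ i, X i ^ d (k, i) : MvPolynomial (Fin p ⊕ Fin q) ℝ) := by
    ext x
    rw [evalPoly, eval_eq']
    refine Finset.sum_congr rfl fun d _ => ?_
    rw [Fintype.prod_prod_type]
    simp
  rw [h]
  refine integrable_finsetSum _ fun d _ => Integrable.const_mul ?_ _
  exact Integrable.fintype_prod (μ := fun _ : Fin n => multivariateGaussian 0 S)
    (f := fun k (y : Obs p q) =>
      eval (fun i => y i) (∏ i, X i ^ d (k, i) : MvPolynomial (Fin p ⊕ Fin q) ℝ))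
    fun k => integrable_eval_multivariateGaussian S _

lemma integral_evalPoly_hermiteProd (S : Matrix (Fin p ⊕ Fin q) (Fin p ⊕ Fin q) ℝ)
    (γ : Fin n × (Fin p ⊕ Fin q) → ℕ) :
    ∫ x, evalPoly (hermiteProd γ) x ∂(iidLaw n (multivariateGaussian 0 S)) =
      ∏ k, gaussianMean S (hermiteProd fun i => γ (k, i)) := by
  simp only [evalPoly_hermiteProd]
  exact integral_fintype_prod_eq_prod
    fun k (y : Obs p q) => eval (fun i => y i) (hermiteProd fun i => γ (k, i))

lemma integral_evalPoly_hermiteProd_mul (γ δ : Fin n × (Fin p ⊕ Fin q) → ℕ) :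
    ∫ x, evalPoly (hermiteProd γ) x * evalPoly (hermiteProd δ) x ∂(iidLaw n (nullLaw p q)) =
      if γ = δ then ∏ c, ((γ c).factorial : ℝ) else 0 := by
  simp only [evalPoly_hermiteProd, ← Finset.prod_mul_distrib, ← map_mul]
  have h := integral_fintype_prod_eq_prod (μ := fun _ : Fin n => nullLaw p q)
    fun k (y : Obs p q) => eval (fun i => y i)
      (hermiteProd (fun i => γ (k, i)) * hermiteProd (fun i => δ (k, i)))
  refine h.trans ((Finset.prod_congr rfl fun k _ =>
    gaussianMean_one_hermiteProd_mul (fun i => γ (k, i)) fun i => δ (k, i)).trans ?_)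
  split_ifs with hγ
  · subst hγ
    simp [Fintype.prod_prod_type]
  · obtain ⟨⟨k, i⟩, hki⟩ := Function.ne_iff.1 hγ
    refine Finset.prod_eq_zero (Finset.mem_univ k) (if_neg fun h => hki (congrFun h i))

lemma evalPoly_sum_C_mul {ι : Type*} (s : Finset ι) (c : ι → ℝ)
    (H : ι → MvPolynomial (Fin n × (Fin p ⊕ Fin q)) ℝ) (x : Sample n p q) :
    evalPoly (∑ γ ∈ s, C (c γ) * H γ) x = ∑ γ ∈ s, c γ * evalPoly (H γ) x := by
  simp [evalPoly]

lemma integral_evalPoly_sq (s : Finset (Fin n × (Fin p ⊕ Fin q) → ℕ))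
    (c : (Fin n × (Fin p ⊕ Fin q) → ℕ) → ℝ) :
    ∫ x, evalPoly (∑ γ ∈ s, C (c γ) * hermiteProd γ) x ^ 2 ∂(iidLaw n (nullLaw p q)) =
      ∑ γ ∈ s, c γ ^ 2 * ∏ i, ((γ i).factorial : ℝ) := by
  have hint : ∀ γ δ : Fin n × (Fin p ⊕ Fin q) → ℕ,
      Integrable (fun x => evalPoly (hermiteProd γ) x * evalPoly (hermiteProd δ) x)
        (iidLaw n (nullLaw p q)) := by
    intro γ δ
    have := integrable_evalPoly_iidLaw (n := n) (1 : Matrix (Fin p ⊕ Fin q) (Fin p ⊕ Fin q) ℝ)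
      (hermiteProd γ * hermiteProd δ)
    refine this.congr (ae_of_all _ fun x => ?_)
    simp only [evalPoly, map_mul]
  simp only [evalPoly_sum_C_mul, pow_two, Finset.sum_mul_sum]
  simp only [mul_mul_mul_comm]
  rw [integral_finsetSum _ fun γ _ => integrable_finsetSum _ fun δ _ => (hint γ δ).const_mul _]
  refine Finset.sum_congr rfl fun γ hγ => ?_
  rw [integral_finsetSum _ fun δ _ => (hint γ δ).const_mul _]
  simp only [integral_const_mul, integral_evalPoly_hermiteProd_mul]
  simp [hγ]

/-- The low-degree norm is controlled by the Hermite coefficients. -/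
lemma lowDegreeNorm_le {P : Measure (Sample n p q)} {D : ℕ} {K : ℝ} (hK : 0 ≤ K)
    (hP : ∀ f : MvPolynomial (Fin n × (Fin p ⊕ Fin q)) ℝ, Integrable (evalPoly f) P)
    (h : ∑ γ ∈ multiIndices (Fin n × (Fin p ⊕ Fin q)) D,
      (∫ x, evalPoly (hermiteProd γ) x ∂P) ^ 2 / ∏ i, ((γ i).factorial : ℝ) ≤ K ^ 2) :
    lowDegreeNorm P (iidLaw n (nullLaw p q)) D ≤ ENNReal.ofReal K := by
  refine iSup_le fun ⟨f, hf⟩ => ENNReal.ofReal_le_ofReal ?_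
  -- The denominator may be zero; then the quotient is `0` by convention and `0 ≤ K` suffices.
  refine div_le_of_le_mul₀ (Real.sqrt_nonneg _) hK ?_
  obtain ⟨c, rfl⟩ := exists_eq_sum_hermiteProd hf
  rw [integral_evalPoly_sq]
  simp only [evalPoly_sum_C_mul]
  rw [integral_finsetSum _ fun γ _ => (hP _).const_mul _]
  simp only [integral_const_mul]
  have hfac : ∀ γ : Fin n × (Fin p ⊕ Fin q) → ℕ, 0 < ∏ i, ((γ i).factorial : ℝ) :=
    fun γ => Finset.prod_pos fun i _ => by positivity
  refine le_of_sq_le_sq ?_ (by positivity)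
  rw [mul_pow, Real.sq_sqrt (Finset.sum_nonneg fun γ _ => mul_nonneg (sq_nonneg _) (hfac γ).le)]
  refine le_trans ?_ (mul_le_mul_of_nonneg_right h
    (Finset.sum_nonneg fun γ _ => mul_nonneg (sq_nonneg _) (hfac γ).le))
  -- Cauchy–Schwarz after normalizing each Hermite product by its norm, the square root of `γ!`.
  have hcs := Finset.sum_mul_sq_le_sq_mul_sq (multiIndices (Fin n × (Fin p ⊕ Fin q)) D)
    (fun γ => (∫ x, evalPoly (hermiteProd γ) x ∂P) / √(∏ i, ((γ i).factorial : ℝ)))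
    (fun γ => c γ * √(∏ i, ((γ i).factorial : ℝ)))
  simp only [div_pow, mul_pow, Real.sq_sqrt (hfac _).le] at hcs
  refine le_trans (le_of_eq ?_) hcs
  congr 1
  refine Finset.sum_congr rfl fun γ _ => ?_
  have := (Real.sqrt_pos.2 (hfac γ)).ne'
  field_simp

end Samples

/-! ### The second moment of the low-degree likelihood ratio -/

section SecondMoment

variable {n p q : ℕ}

lemma multinomial_mul_prod {m d : ℕ} {γ : Fin m → ℕ} (h : γ ∈ Finset.univ.piAntidiag d)
    (c : ℝ) :
    (Nat.multinomial Finset.univ γ : ℝ) * c = d.factorial * c / ∏ i, ((γ i).factorial : ℝ) := by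
  have hs := Nat.multinomial_spec Finset.univ γ
  rw [(Finset.mem_piAntidiag.1 h).1] at hs
  have hpos : (0 : ℝ) < ∏ i, ((γ i).factorial : ℝ) :=
    Finset.prod_pos fun i _ => by positivity
  rw [eq_div_iff hpos.ne', ← hs]
  push_cast
  ring

/-- The two factors `d!` of the coefficients, divided by the factorials of both multi-indices, are
exactly two multinomial coefficients. The sum is thus the expansion of the `d`-th powers of the two
inner products. -/
lemma sum_spikedCoeff_mul (a a' : Fin p → ℝ) (b b' : Fin q → ℝ) (ρ : ℝ) (d : ℕ) :
    ∑ u ∈ (Finset.univ.piAntidiag d : Finset (Fin p → ℕ)) ×ˢ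
        (Finset.univ.piAntidiag d : Finset (Fin q → ℕ)),
      spikedCoeff a b ρ (Sum.elim u.1 u.2) * spikedCoeff a' b' ρ (Sum.elim u.1 u.2) /
        ∏ i, ((Sum.elim u.1 u.2 i).factorial : ℝ) =
      (ρ ^ 2 * ((∑ i, a i * a' i) * ∑ j, b j * b' j)) ^ d := by
  rw [mul_pow, mul_pow, Finset.sum_pow_eq_sum_piAntidiag, Finset.sum_pow_eq_sum_piAntidiag,
    Finset.sum_mul_sum, Finset.mul_sum, Finset.sum_product]
  refine Finset.sum_congr rfl fun u hu => ?_
  rw [Finset.mul_sum]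
  refine Finset.sum_congr rfl fun v hv => ?_
  rw [multinomial_mul_prod hu, multinomial_mul_prod hv]
  simp only [spikedCoeff, Sum.elim_inl, Sum.elim_inr, (Finset.mem_piAntidiag.1 hu).1,
    (Finset.mem_piAntidiag.1 hv).1, if_true, Fintype.prod_sum_type, mul_pow,
    Finset.prod_mul_distrib]
  have h1 : (0 : ℝ) < ∏ i, ((u i).factorial : ℝ) := Finset.prod_pos fun i _ => by positivity
  have h2 : (0 : ℝ) < ∏ i, ((v i).factorial : ℝ) := Finset.prod_pos fun i _ => by positivity
  field_simp
  ring

/-- Only indices balanced between `X` and `Y` in every observation contribute. If observation `k`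
has degree `d k` on each side, the total degree is `2 ∑ d k`, hence the bound `D / 2`. -/
lemma sum_multiIndices_spikedCoeff (a a' : Fin p → ℝ) (b b' : Fin q → ℝ) (ρ : ℝ) (D : ℕ) :
    ∑ γ ∈ multiIndices (Fin n × (Fin p ⊕ Fin q)) D,
      (∏ k, spikedCoeff a b ρ fun i => γ (k, i)) * (∏ k, spikedCoeff a' b' ρ fun i => γ (k, i)) /
        ∏ c, ((γ c).factorial : ℝ) =
      ∑ d ∈ multiIndices (Fin n) (D / 2),
        (ρ ^ 2 * ((∑ i, a i * a' i) * ∑ j, b j * b' j)) ^ (∑ k, d k) := by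
  have hprod : ∀ γ : Fin n × (Fin p ⊕ Fin q) → ℕ,
      (∏ k, spikedCoeff a b ρ fun i => γ (k, i)) * (∏ k, spikedCoeff a' b' ρ fun i => γ (k, i)) /
        ∏ c, ((γ c).factorial : ℝ) = ∏ k, spikedCoeff a b ρ (fun i => γ (k, i)) *
          spikedCoeff a' b' ρ (fun i => γ (k, i)) / ∏ i, ((γ (k, i)).factorial : ℝ) := by
    intro γ
    rw [Fintype.prod_prod_type (fun c => ((γ c).factorial : ℝ)), Finset.prod_div_distrib,
      Finset.prod_mul_distrib]
  simp only [hprod, ← Finset.prod_pow_eq_pow_sum, ← sum_spikedCoeff_mul, Finset.prod_univ_sum]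
  rw [Finset.sum_sigma']
  symm
  -- A pair consisting of degrees `d` and multi-indices of those degrees is flattened into a single
  -- `γ`. An index outside the image is unbalanced in some observation and has a zero factor there.
  refine Finset.sum_of_injOn
    (fun u c => Sum.elim (u.2 c.1).1 (u.2 c.1).2 c.2) ?_ ?_ ?_ ?_
  · rintro ⟨d, u⟩ hu ⟨d', u'⟩ hu' h
    simp only [Finset.coe_sigma, Set.mem_sigma_iff, Finset.mem_coe, Fintype.mem_piFinset,
      Finset.mem_product, Finset.mem_piAntidiag] at hu hu'
    have h1 : ∀ k, u k = u' k := fun k => Prod.ext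
      (funext fun i => congrFun h (k, Sum.inl i)) (funext fun j => congrFun h (k, Sum.inr j))
    have h2 : u = u' := funext h1
    subst h2
    have h3 : d = d' := funext fun k => by rw [← (hu.2 k).1.1, ← (hu'.2 k).1.1]
    subst h3
    rfl
  · rintro ⟨d, u⟩ hu
    simp only [Finset.coe_sigma, Set.mem_sigma_iff, Finset.mem_coe, Fintype.mem_piFinset,
      Finset.mem_product, Finset.mem_piAntidiag, mem_multiIndices] at hu ⊢
    rw [Fintype.sum_prod_type]
    have : ∀ k, ∑ i, Sum.elim (u k).1 (u k).2 i = 2 * d k := fun k => by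
      rw [Fintype.sum_sum_type]
      simp only [Sum.elim_inl, Sum.elim_inr, (hu.2 k).1.1, (hu.2 k).2.1]
      ring
    simp only [this, ← Finset.mul_sum]
    omega
  · intro γ hγ hγ'
    by_cases hbal : ∀ k, ∑ i, γ (k, Sum.inl i) = ∑ j, γ (k, Sum.inr j)
    · refine absurd ⟨⟨fun k => ∑ i, γ (k, Sum.inl i),
        fun k => (fun i => γ (k, Sum.inl i), fun j => γ (k, Sum.inr j))⟩, ?_, ?_⟩ hγ'
      · rw [mem_multiIndices, Fintype.sum_prod_type] at hγ
        simp only [Fintype.sum_sum_type, ← hbal, ← two_mul, ← Finset.mul_sum] at hγ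
        simp only [Finset.coe_sigma, Set.mem_sigma_iff, Finset.mem_coe, Fintype.mem_piFinset,
          Finset.mem_product, Finset.mem_piAntidiag, mem_multiIndices]
        refine ⟨by omega, fun k => ⟨⟨by simp, by simp⟩, ⟨(hbal k).symm, by simp⟩⟩⟩
      · ext ⟨k, i | j⟩ <;> rfl
    · push Not at hbal
      obtain ⟨k, hk⟩ := hbal
      refine Finset.prod_eq_zero (Finset.mem_univ k) ?_
      rw [spikedCoeff, if_neg hk]
      simp
  · rintro ⟨d, u⟩ hu
    rfl

/-- The `e`-th moment of the inner product of two independent random sign vectors. -/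
noncomputable def overlapMoment (p s e : ℕ) : ℝ :=
  (((signPatterns p s).card : ℝ) ^ 2)⁻¹ * ∑ σ ∈ signPatterns p s, ∑ σ' ∈ signPatterns p s,
    (∑ i, signVector s σ i * signVector s σ' i) ^ e

/-! ### Sign vectors and the Hermite coefficients of the mixture -/

lemma mem_signPatterns {s : ℕ} {σ : Fin p → SignType} :
    σ ∈ signPatterns p s ↔ (Finset.univ.filter fun i => σ i ≠ 0).card = s := by
  simp [signPatterns]

lemma signType_sq (x : SignType) : ((x : SignType) : ℝ) ^ 2 = if x ≠ 0 then 1 else 0 := by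
  cases x <;> simp

lemma sum_signVector_sq {s : ℕ} (hs : s ≠ 0) {σ : Fin p → SignType} (h : σ ∈ signPatterns p s) :
    ∑ i, signVector s σ i ^ 2 = 1 := by
  simp only [signVector, div_pow, ← Finset.sum_div, signType_sq]
  rw [Finset.sum_boole, Real.sq_sqrt (Nat.cast_nonneg _), mem_signPatterns.1 h]
  exact div_self (Nat.cast_ne_zero.2 hs)

/-- Both vectors have norm one and `1 < B`, so the truncation in `plantedLaw` never takes effect. -/
lemma plantedLaw_signVector {sx sy : ℕ} {B : ℝ} (hB : 1 < B) (hsx : sx ≠ 0) (hsy : sy ≠ 0)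
    {σ : Fin p → SignType} (hσ : σ ∈ signPatterns p sx)
    {τ : Fin q → SignType} (hτ : τ ∈ signPatterns q sy) :
    plantedLaw B (signVector sx σ) (signVector sy τ) =
      multivariateGaussian 0 (spikedCov (signVector sx σ) (signVector sy τ) (1 / B)) := by
  rw [plantedLaw, sum_signVector_sq hsx hσ, sum_signVector_sq hsy hτ, if_pos]
  simpa using hB

lemma posDef_spikedCov_signVector {sx sy : ℕ} {B : ℝ} (hB : 1 < B) (hsx : sx ≠ 0) (hsy : sy ≠ 0)
    {σ : Fin p → SignType} (hσ : σ ∈ signPatterns p sx)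
    {τ : Fin q → SignType} (hτ : τ ∈ signPatterns q sy) :
    (spikedCov (signVector sx σ) (signVector sy τ) (1 / B)).PosDef :=
  posDef_spikedCov (sum_signVector_sq hsx hσ) (sum_signVector_sq hsy hτ) (by positivity)
    (by rw [div_lt_one (by linarith)]; exact hB)

lemma integrable_evalPoly_plantedLaw (B : ℝ) (a : Fin p → ℝ) (b : Fin q → ℝ)
    (f : MvPolynomial (Fin n × (Fin p ⊕ Fin q)) ℝ) :
    Integrable (evalPoly f) (iidLaw n (plantedLaw B a b)) := by
  rw [plantedLaw]
  split_ifs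
  · exact integrable_evalPoly_iidLaw _ f
  · exact integrable_evalPoly_iidLaw _ f

lemma integrable_evalPoly_plantedMixture {sx sy : ℕ} (B : ℝ) (hx : (signPatterns p sx).Nonempty)
    (hy : (signPatterns q sy).Nonempty) (f : MvPolynomial (Fin n × (Fin p ⊕ Fin q)) ℝ) :
    Integrable (evalPoly f) (plantedMixture n p q sx sy B) := by
  refine Integrable.smul_measure ?_ ?_
  · refine integrable_finsetSum_measure.2 fun σ _ => integrable_finsetSum_measure.2 fun τ _ => ?_
    exact integrable_evalPoly_plantedLaw B _ _ f
  · rw [ne_eq, ENNReal.inv_eq_top]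
    exact_mod_cast (mul_pos hx.card_pos hy.card_pos).ne'

lemma integral_evalPoly_plantedMixture (sx sy : ℕ) (B : ℝ)
    (f : MvPolynomial (Fin n × (Fin p ⊕ Fin q)) ℝ) :
    ∫ x, evalPoly f x ∂(plantedMixture n p q sx sy B) =
      (((signPatterns p sx).card : ℝ) * (signPatterns q sy).card)⁻¹ *
        ∑ σ ∈ signPatterns p sx, ∑ τ ∈ signPatterns q sy,
          ∫ x, evalPoly f x ∂(iidLaw n (plantedLaw B (signVector sx σ) (signVector sy τ))) := by
  rw [plantedMixture, integral_smul_measure, integral_finsetSum_measure]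
  · rw [smul_eq_mul]
    congr 1
    · simp
    · refine Finset.sum_congr rfl fun σ _ => ?_
      rw [integral_finsetSum_measure]
      exact fun τ _ => integrable_evalPoly_plantedLaw B _ _ f
  · exact fun σ _ => integrable_finsetSum_measure.2 fun τ _ =>
      integrable_evalPoly_plantedLaw B _ _ f

lemma integral_hermiteProd_plantedMixture {sx sy : ℕ} {B : ℝ} (hB : 1 < B) (hsx : sx ≠ 0)
    (hsy : sy ≠ 0) (γ : Fin n × (Fin p ⊕ Fin q) → ℕ) :
    ∫ x, evalPoly (hermiteProd γ) x ∂(plantedMixture n p q sx sy B) =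
      (((signPatterns p sx).card : ℝ) * (signPatterns q sy).card)⁻¹ *
        ∑ σ ∈ signPatterns p sx, ∑ τ ∈ signPatterns q sy,
          ∏ k, spikedCoeff (signVector sx σ) (signVector sy τ) (1 / B) fun i => γ (k, i) := by
  rw [integral_evalPoly_plantedMixture]
  congr 1
  refine Finset.sum_congr rfl fun σ hσ => Finset.sum_congr rfl fun τ hτ => ?_
  rw [plantedLaw_signVector hB hsx hsy hσ hτ, integral_evalPoly_hermiteProd]
  refine Finset.prod_congr rfl fun k _ => ?_
  exact gaussianMean_spikedCov_hermiteProd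
    (posDef_spikedCov_signVector hB hsx hsy hσ hτ).posSemidef _

/-- The square of an average over `(σ, τ)` is an average over two independent copies. Summing over
`γ` first leaves a power of the product of the two overlaps, whose averages factor. -/
lemma sum_sq_integral_hermiteProd_plantedMixture {sx sy : ℕ} {B : ℝ} (hB : 1 < B) (hsx : sx ≠ 0)
    (hsy : sy ≠ 0) (D : ℕ) :
    ∑ γ ∈ multiIndices (Fin n × (Fin p ⊕ Fin q)) D,
      (∫ x, evalPoly (hermiteProd γ) x ∂(plantedMixture n p q sx sy B)) ^ 2 /
        ∏ i, ((γ i).factorial : ℝ) =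
      ∑ d ∈ multiIndices (Fin n) (D / 2), (1 / B) ^ (2 * ∑ k, d k) *
        (overlapMoment p sx (∑ k, d k) * overlapMoment q sy (∑ k, d k)) := by
  have h1 : ∀ γ : Fin n × (Fin p ⊕ Fin q) → ℕ,
      (∫ x, evalPoly (hermiteProd γ) x ∂(plantedMixture n p q sx sy B)) ^ 2 /
        ∏ i, ((γ i).factorial : ℝ) =
      (((signPatterns p sx).card : ℝ) ^ 2)⁻¹ * (((signPatterns q sy).card : ℝ) ^ 2)⁻¹ *
        ∑ σ ∈ signPatterns p sx, ∑ σ' ∈ signPatterns p sx,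
        ∑ τ ∈ signPatterns q sy, ∑ τ' ∈ signPatterns q sy,
          (∏ k, spikedCoeff (signVector sx σ) (signVector sy τ) (1 / B) fun i => γ (k, i)) *
          (∏ k, spikedCoeff (signVector sx σ') (signVector sy τ') (1 / B) fun i => γ (k, i)) /
          ∏ i, ((γ i).factorial : ℝ) := by
    intro γ
    rw [integral_hermiteProd_plantedMixture hB hsx hsy, mul_pow, mul_inv, mul_pow, inv_pow, inv_pow,
      mul_div_assoc]
    congr 1
    rw [pow_two, Finset.sum_mul_sum]
    simp only [Finset.sum_mul_sum, Finset.sum_div]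
  simp only [h1]
  rw [← Finset.mul_sum, Finset.sum_comm]
  have h2 : ∀ e : ℕ, (1 / B) ^ (2 * e) * (overlapMoment p sx e * overlapMoment q sy e) =
      (((signPatterns p sx).card : ℝ) ^ 2)⁻¹ * (((signPatterns q sy).card : ℝ) ^ 2)⁻¹ *
        ∑ σ ∈ signPatterns p sx, ∑ σ' ∈ signPatterns p sx,
        ∑ τ ∈ signPatterns q sy, ∑ τ' ∈ signPatterns q sy,
          ((1 / B) ^ 2 * ((∑ i, signVector sx σ i * signVector sx σ' i) *
            ∑ j, signVector sy τ j * signVector sy τ' j)) ^ e := by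
    intro e
    simp only [overlapMoment, mul_pow, pow_mul, ← Finset.mul_sum, ← Finset.sum_mul]
    ring
  simp only [h2]
  rw [← Finset.mul_sum]
  congr 1
  conv_rhs => rw [Finset.sum_comm]
  refine Finset.sum_congr rfl fun σ _ => ?_
  rw [Finset.sum_comm]
  conv_rhs => rw [Finset.sum_comm]
  refine Finset.sum_congr rfl fun σ' _ => ?_
  rw [Finset.sum_comm]
  conv_rhs => rw [Finset.sum_comm]
  refine Finset.sum_congr rfl fun τ _ => ?_
  rw [Finset.sum_comm]
  conv_rhs => rw [Finset.sum_comm]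
  refine Finset.sum_congr rfl fun τ' _ => ?_
  exact sum_multiIndices_spikedCoeff _ _ _ _ _ _

end SecondMoment

/-! ### Moments of the overlap of random sign vectors -/

section Moments

variable {p s : ℕ}

/-- The number of perfect matchings of `2 * m` points, as a real number. -/
noncomputable def matchingNumber (m : ℕ) : ℝ := ((2 * m).factorial : ℝ) / (2 ^ m * m.factorial)

lemma matchingNumber_nonneg (m : ℕ) : 0 ≤ matchingNumber m := by
  unfold matchingNumber
  positivity

/-- The comparison of coefficients needed for the induction in Khintchine's inequality; after
cancellation it is `2^j j! ≤ (2j)!`. -/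
lemma choose_mul_matchingNumber_le {m j : ℕ} (hj : j ≤ m) :
    ((2 * m).choose (2 * j) : ℝ) * matchingNumber (m - j) ≤ matchingNumber m * m.choose j := by
  have h2 : ((2 : ℝ) ^ j * j.factorial) ≤ (2 * j).factorial := by
    exact_mod_cast Nat.two_pow_mul_factorial_le_factorial_two_mul j
  obtain ⟨k, rfl⟩ := Nat.exists_eq_add_of_le hj
  rw [Nat.add_sub_cancel_left, Nat.cast_choose ℝ (by omega), Nat.cast_choose ℝ (by omega),
    show 2 * (j + k) - 2 * j = 2 * k by omega, Nat.add_sub_cancel_left]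
  unfold matchingNumber
  have e1 : ((2 * (j + k)).factorial : ℝ) / ((2 * j).factorial * (2 * k).factorial) *
      ((2 * k).factorial / (2 ^ k * k.factorial)) =
      (2 * (j + k)).factorial / ((2 * j).factorial * (2 ^ k * k.factorial)) := by
    field_simp
  have e2 : ((2 * (j + k)).factorial : ℝ) / (2 ^ (j + k) * (j + k).factorial) *
      ((j + k).factorial / (j.factorial * k.factorial)) =
      (2 * (j + k)).factorial / ((2 ^ j * j.factorial) * (2 ^ k * k.factorial)) := by
    rw [pow_add]
    field_simp
  rw [e1, e2]
  gcongr

lemma sum_range_even {a : ℕ → ℝ} (h : ∀ j, a (2 * j + 1) = 0) (m : ℕ) :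
    ∑ k ∈ Finset.range (2 * m + 1), a k = ∑ j ∈ Finset.range (m + 1), a (2 * j) := by
  induction m with
  | zero => simp
  | succ m ih =>
    rw [show 2 * (m + 1) + 1 = 2 * m + 1 + 1 + 1 by ring, Finset.sum_range_succ,
      Finset.sum_range_succ, ih, h, Finset.sum_range_succ _ (m + 1)]
    ring_nf

lemma add_pow_add_neg_add_pow (c z : ℝ) (m : ℕ) :
    (c + z) ^ (2 * m) + (-c + z) ^ (2 * m) =
      2 * ∑ j ∈ Finset.range (m + 1), (c ^ 2) ^ j * z ^ (2 * (m - j)) * (2 * m).choose (2 * j) := by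
  rw [add_pow, add_pow, ← Finset.sum_add_distrib, sum_range_even, Finset.mul_sum]
  · refine Finset.sum_congr rfl fun j _ => ?_
    rw [← Nat.mul_sub, pow_mul (-c), neg_sq, ← pow_mul]
    ring
  · intro j
    rw [Odd.neg_pow ⟨j, rfl⟩]
    ring

/-- The real number `1` or `-1` attached to a Boolean. -/
noncomputable def boolSign (b : Bool) : ℝ := if b then 1 else -1

/-- Khintchine's inequality for even moments. -/
lemma sum_boolSign_pow_le (c : Fin p → ℝ) (m : ℕ) :
    ∑ ε : Fin p → Bool, (∑ i, boolSign (ε i) * c i) ^ (2 * m) ≤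
      2 ^ p * (matchingNumber m * (∑ i, c i ^ 2) ^ m) := by
  induction p generalizing m with
  | zero =>
    rcases m with _ | m
    · simp [matchingNumber]
    · simp
  | succ p ih =>
    -- Summing over the first sign cancels the odd powers of `c 0`. The even ones are compared term
    -- by term with the binomial expansion of `(c 0 ^ 2 + V)^m`, where `V` is the sum of the
    -- remaining squares.
    rw [← (Fin.consEquiv fun _ => Bool).sum_comp, Fintype.sum_prod_type, Fintype.sum_bool]
    simp only [Fin.consEquiv_apply, Fin.sum_univ_succ, Fin.cons_zero, Fin.cons_succ, boolSign,
      if_true, Bool.false_eq_true, if_false, one_mul, neg_one_mul]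
    rw [← Finset.sum_add_distrib]
    simp only [add_pow_add_neg_add_pow]
    rw [← Finset.mul_sum, Finset.sum_comm, pow_succ' 2 p, mul_assoc]
    refine mul_le_mul_of_nonneg_left ?_ zero_le_two
    rw [add_pow, Finset.mul_sum, Finset.mul_sum]
    refine Finset.sum_le_sum fun j hj => ?_
    have hjm : j ≤ m := Nat.lt_succ_iff.1 (Finset.mem_range.1 hj)
    have h1 := ih (fun i => c i.succ) (m - j)
    simp only [boolSign] at h1
    have h2 := choose_mul_matchingNumber_le hjm
    have hV : 0 ≤ ∑ i : Fin p, c i.succ ^ 2 := Finset.sum_nonneg fun _ _ => sq_nonneg _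
    rw [← Finset.sum_mul, ← Finset.mul_sum]
    calc _ ≤ (c 0 ^ 2) ^ j * (2 ^ p * (matchingNumber (m - j) *
          (∑ i : Fin p, c i.succ ^ 2) ^ (m - j))) * (2 * m).choose (2 * j) := by gcongr
      _ = (2 ^ p * ((c 0 ^ 2) ^ j * (∑ i : Fin p, c i.succ ^ 2) ^ (m - j))) *
          ((2 * m).choose (2 * j) * matchingNumber (m - j)) := by ring
      _ ≤ (2 ^ p * ((c 0 ^ 2) ^ j * (∑ i : Fin p, c i.succ ^ 2) ^ (m - j))) *
          (matchingNumber m * m.choose j) := by gcongr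
      _ = _ := by ring

/-- The signs of `σ` flipped where `ε` is false. -/
def flipSigns (ε : Fin p → Bool) (σ : Fin p → SignType) : Fin p → SignType :=
  fun i => if ε i then σ i else -σ i

lemma flipSigns_ne_zero (ε : Fin p → Bool) (σ : Fin p → SignType) (i : Fin p) :
    flipSigns ε σ i ≠ 0 ↔ σ i ≠ 0 := by
  unfold flipSigns
  split_ifs
  · rfl
  · cases σ i <;> simp

lemma flipSigns_mem {ε : Fin p → Bool} {σ : Fin p → SignType} (h : σ ∈ signPatterns p s) :
    flipSigns ε σ ∈ signPatterns p s := by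
  rw [mem_signPatterns] at h ⊢
  simpa only [flipSigns_ne_zero] using h

lemma flipSigns_flipSigns (ε : Fin p → Bool) (σ : Fin p → SignType) :
    flipSigns ε (flipSigns ε σ) = σ := by
  ext i
  unfold flipSigns
  split_ifs <;> simp

lemma signVector_flipSigns (ε : Fin p → Bool) (σ : Fin p → SignType) (i : Fin p) :
    signVector s (flipSigns ε σ) i = boolSign (ε i) * signVector s σ i := by
  unfold signVector flipSigns boolSign
  split_ifs
  · simp
  · cases σ i <;> simp [neg_div]

lemma sum_signPatterns_flipSigns (ε : Fin p → Bool) (F : (Fin p → SignType) → ℝ) :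
    ∑ σ ∈ signPatterns p s, F (flipSigns ε σ) = ∑ σ ∈ signPatterns p s, F σ :=
  Finset.sum_nbij' (flipSigns ε) (flipSigns ε) (fun _ => flipSigns_mem) (fun _ => flipSigns_mem)
    (fun σ _ => flipSigns_flipSigns ε σ) (fun σ _ => flipSigns_flipSigns ε σ) fun _ _ => rfl

/-- Flipping all signs of `σ` permutes the sign patterns and negates the inner product. -/
lemma overlapMoment_odd {e : ℕ} (he : Odd e) : overlapMoment p s e = 0 := by
  rw [overlapMoment]
  have h : ∑ σ ∈ signPatterns p s, ∑ σ' ∈ signPatterns p s,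
      (∑ i, signVector s σ i * signVector s σ' i) ^ e =
      -∑ σ ∈ signPatterns p s, ∑ σ' ∈ signPatterns p s,
      (∑ i, signVector s σ i * signVector s σ' i) ^ e := by
    conv_lhs => rw [← sum_signPatterns_flipSigns (fun _ => false)]
    simp [signVector_flipSigns, boolSign, he.neg_pow]
  rw [self_eq_neg.1 h, mul_zero]

lemma overlapMoment_even_nonneg (m : ℕ) : 0 ≤ overlapMoment p s (2 * m) :=
  mul_nonneg (by positivity) (Finset.sum_nonneg fun σ _ => Finset.sum_nonneg fun σ' _ =>
    (even_two_mul m).pow_nonneg _)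

/-- The number of sign patterns that do not vanish on `A`. -/
noncomputable def coverCount (s : ℕ) (A : Finset (Fin p)) : ℝ :=
  ∑ σ ∈ signPatterns p s, ∏ i ∈ A, if σ i ≠ 0 then 1 else 0

lemma coverCount_nonneg (A : Finset (Fin p)) : 0 ≤ coverCount s A :=
  Finset.sum_nonneg fun σ _ => Finset.prod_nonneg fun i _ => by split_ifs <;> simp

lemma comp_perm_mem {σ : Fin p → SignType} (π : Equiv.Perm (Fin p)) (h : σ ∈ signPatterns p s) :
    σ ∘ π ∈ signPatterns p s := by
  rw [mem_signPatterns] at h ⊢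
  rw [← h]
  refine Finset.card_bij' (fun i _ => π i) (fun i _ => π.symm i) ?_ ?_ ?_ ?_ <;> simp

/-- Exchangeability: the transposition of `i` and `j` permutes the sign patterns and fixes `A`
pointwise. -/
lemma coverCount_insert_eq {A : Finset (Fin p)} {i j : Fin p} (hi : i ∉ A) (hj : j ∉ A) :
    coverCount s (insert i A) = coverCount s (insert j A) := by
  refine Finset.sum_nbij' (fun σ => σ ∘ Equiv.swap i j) (fun σ => σ ∘ Equiv.swap i j)
    (fun σ h => comp_perm_mem _ h) (fun σ h => comp_perm_mem _ h) ?_ ?_ ?_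
  · intro σ _
    ext l
    simp
  · intro σ _
    ext l
    simp
  · intro σ _
    rw [Finset.prod_insert hi, Finset.prod_insert hj]
    congr 1
    · simp
    · refine Finset.prod_congr rfl fun l hl => ?_
      rw [Function.comp_apply, Equiv.swap_apply_of_ne_of_ne (ne_of_mem_of_not_mem hl hi)
        (ne_of_mem_of_not_mem hl hj)]

/-- Double counting: a pattern nonzero on all of `A` has `s - |A|` further support points. -/
lemma sum_coverCount_insert (A : Finset (Fin p)) :
    ∑ i ∈ Aᶜ, coverCount s (insert i A) = (s - A.card) * coverCount s A := by
  simp only [coverCount]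
  rw [Finset.sum_comm, Finset.mul_sum]
  refine Finset.sum_congr rfl fun σ hσ => ?_
  have h1 : ∀ i ∈ Aᶜ, (∏ l ∈ insert i A, if σ l ≠ 0 then (1 : ℝ) else 0) =
      (if σ i ≠ 0 then 1 else 0) * ∏ l ∈ A, if σ l ≠ 0 then (1 : ℝ) else 0 := fun i hi => by
    rw [Finset.prod_insert (Finset.mem_compl.1 hi)]
  rw [Finset.sum_congr rfl h1, ← Finset.sum_mul]
  by_cases h : ∀ l ∈ A, σ l ≠ 0
  · congr 1
    have h2 := Finset.sum_add_sum_compl A fun i => if σ i ≠ 0 then (1 : ℝ) else 0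
    have h3 : ∑ i, (if σ i ≠ 0 then (1 : ℝ) else 0) = s := by
      rw [Finset.sum_boole, mem_signPatterns.1 hσ]
    rw [h3, Finset.sum_congr rfl fun l hl => if_pos (h l hl), Finset.sum_const, nsmul_one] at h2
    linarith
  · push Not at h
    obtain ⟨l, hl, hl0⟩ := h
    rw [Finset.prod_eq_zero hl (by simp [hl0]), mul_zero, mul_zero]

/-- By exchangeability and double counting, the exact ratio is `(s - |A|)/(p - |A|)`, which is at
most `s/p` because `s ≤ p`. The support is sampled without replacement, so covering `A` makes a
further point no more likely. -/
lemma coverCount_insert_le (hs : s ≤ p) {A : Finset (Fin p)} {i : Fin p} (hi : i ∉ A) :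
    coverCount s (insert i A) ≤ s / p * coverCount s A := by
  have h1 := sum_coverCount_insert (s := s) A
  rw [Finset.sum_congr rfl fun j hj => coverCount_insert_eq (Finset.mem_compl.1 hj) hi,
    Finset.sum_const, Finset.card_compl, Fintype.card_fin, nsmul_eq_mul] at h1
  have hlt : A.card < p := by
    have := Finset.card_lt_univ_of_notMem hi
    simpa using this
  rw [Nat.cast_sub hlt.le] at h1
  have h2 : (A.card : ℝ) < p := by exact_mod_cast hlt
  have h3 : (s : ℝ) ≤ p := by exact_mod_cast hs
  have hp : (0 : ℝ) < p := (Nat.cast_nonneg _).trans_lt h2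
  rw [div_mul_eq_mul_div, le_div_iff₀ hp]
  have h4 : ((p : ℝ) - A.card) * (coverCount s (insert i A) * p) ≤
      (p - A.card) * (s * coverCount s A) := by
    have : (0 : ℝ) ≤ A.card * (p - s) * coverCount s A :=
      mul_nonneg (mul_nonneg (Nat.cast_nonneg _) (sub_nonneg.2 h3)) (coverCount_nonneg A)
    nlinarith
  exact le_of_mul_le_mul_left h4 (sub_pos.2 h2)

/-- The points of `A` change nothing and contribute `|A|`; each of the at most `p` others
contributes at most `(s/p)²`. -/
lemma sum_coverCount_insert_sq_le (hs : s ≤ p) (A : Finset (Fin p)) :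
    ∑ i, coverCount s (insert i A) ^ 2 ≤ (A.card + s ^ 2 / p) * coverCount s A ^ 2 := by
  rw [← Finset.sum_add_sum_compl A, add_mul]
  refine add_le_add (le_of_eq ?_) ?_
  · rw [Finset.sum_congr rfl fun i hi => by rw [Finset.insert_eq_of_mem hi], Finset.sum_const,
      nsmul_eq_mul]
  · have h1 : ∀ i ∈ Aᶜ, coverCount s (insert i A) ^ 2 ≤ (s / p * coverCount s A) ^ 2 :=
      fun i hi => pow_le_pow_left₀ (coverCount_nonneg _)
        (coverCount_insert_le hs (Finset.mem_compl.1 hi)) 2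
    refine (Finset.sum_le_card_nsmul _ _ _ h1).trans ?_
    have h2 : (Aᶜ.card : ℝ) ≤ p := by
      exact_mod_cast (Finset.card_le_univ _).trans_eq (Fintype.card_fin p)
    rw [nsmul_eq_mul]
    refine (mul_le_mul_of_nonneg_right h2 (sq_nonneg _)).trans (le_of_eq ?_)
    rcases Nat.eq_zero_or_pos p with rfl | hp
    · simp
    · field_simp

lemma sum_coverCount_image_sq_le (hs : s ≤ p) (m : ℕ) :
    ∑ w : Fin m → Fin p, coverCount s (Finset.univ.image w) ^ 2 ≤
      (s ^ 2 / p + m) ^ m * ((signPatterns p s).card : ℝ) ^ 2 := by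
  induction m with
  | zero => simp [coverCount]
  | succ m ih =>
    rw [← (Fin.consEquiv fun _ => Fin p).sum_comp, Fintype.sum_prod_type, Finset.sum_comm]
    have h1 : ∀ (w : Fin m → Fin p) (i : Fin p),
        Finset.univ.image ((Fin.consEquiv fun _ : Fin (m + 1) => Fin p) (i, w)) =
          insert i (Finset.univ.image w) := by
      intro w i
      ext l
      simp [Fin.exists_fin_succ, eq_comm]
    simp only [h1]
    have h0 : (0 : ℝ) ≤ s ^ 2 / p := by positivity
    calc ∑ w : Fin m → Fin p, ∑ i, coverCount s (insert i (Finset.univ.image w)) ^ 2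
        ≤ ∑ w : Fin m → Fin p, (s ^ 2 / p + m) * coverCount s (Finset.univ.image w) ^ 2 := by
          refine Finset.sum_le_sum fun w _ => (sum_coverCount_insert_sq_le hs _).trans ?_
          refine mul_le_mul_of_nonneg_right ?_ (sq_nonneg _)
          have : (Finset.univ.image w).card ≤ m := by
            simpa using Finset.card_image_le (s := Finset.univ) (f := w)
          have : ((Finset.univ.image w).card : ℝ) ≤ m := by exact_mod_cast this
          linarith
      -- Prepending a letter to a word of length `m` costs a factor at most `s²/p + m`, since the
      -- word has at most `m` distinct letters. The last step enlarges every factor to `s²/p + m +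
      -- 1`.
      _ ≤ (s ^ 2 / p + m) * ((s ^ 2 / p + m) ^ m * ((signPatterns p s).card : ℝ) ^ 2) := by
          rw [← Finset.mul_sum]
          gcongr
      _ ≤ _ := by
          rw [← mul_assoc, ← pow_succ']
          gcongr
          simp

/-- The `m`-th power of the size of the common support counts words of length `m` in it. For a fixed
word the sum over the two patterns factors into the square of a cover count. -/
lemma sum_common_support_pow_le (hs : s ≤ p) (m : ℕ) :
    ∑ σ ∈ signPatterns p s, ∑ σ' ∈ signPatterns p s,
      (∑ i, (if σ i ≠ 0 then (1 : ℝ) else 0) * if σ' i ≠ 0 then 1 else 0) ^ m ≤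
      (s ^ 2 / p + m) ^ m * ((signPatterns p s).card : ℝ) ^ 2 := by
  refine le_trans (le_of_eq ?_) (sum_coverCount_image_sq_le hs m)
  have h1 : ∀ (w : Fin m → Fin p) (σ : Fin p → SignType),
      (∏ l, if σ (w l) ≠ 0 then (1 : ℝ) else 0) =
        ∏ i ∈ Finset.univ.image w, if σ i ≠ 0 then (1 : ℝ) else 0 := by
    intro w σ
    simp only [Finset.prod_ite_zero, Finset.prod_const_one]
    simp
  simp only [Fintype.sum_pow, Finset.prod_mul_distrib, h1, coverCount, pow_two, Finset.sum_mul_sum]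
  symm
  rw [Finset.sum_comm]
  exact Finset.sum_congr rfl fun σ _ => Finset.sum_comm

/-- Random sign flips of `σ` do not change the sum over patterns, so Khintchine applies with the
supports fixed. The sum of squares there is the size of the common support divided by `s²`. -/
lemma overlapMoment_even_le (hs0 : s ≠ 0) (hs : s ≤ p) (m : ℕ) :
    overlapMoment p s (2 * m) ≤ matchingNumber m * (1 / p + m / s ^ 2) ^ m := by
  have hflip : 2 ^ p * ∑ σ ∈ signPatterns p s, ∑ σ' ∈ signPatterns p s,
      (∑ i, signVector s σ i * signVector s σ' i) ^ (2 * m) =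
      ∑ σ ∈ signPatterns p s, ∑ σ' ∈ signPatterns p s, ∑ ε : Fin p → Bool,
        (∑ i, boolSign (ε i) * (signVector s σ i * signVector s σ' i)) ^ (2 * m) := by
    calc _ = ∑ ε : Fin p → Bool, ∑ σ ∈ signPatterns p s, ∑ σ' ∈ signPatterns p s,
          (∑ i, signVector s σ i * signVector s σ' i) ^ (2 * m) := by simp
      _ = ∑ ε : Fin p → Bool, ∑ σ ∈ signPatterns p s, ∑ σ' ∈ signPatterns p s,
          (∑ i, boolSign (ε i) * (signVector s σ i * signVector s σ' i)) ^ (2 * m) := by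
        refine Finset.sum_congr rfl fun ε _ => ?_
        rw [← sum_signPatterns_flipSigns ε]
        simp only [signVector_flipSigns, mul_assoc]
      _ = _ := by
        rw [Finset.sum_comm]
        exact Finset.sum_congr rfl fun σ _ => Finset.sum_comm
  have hsq : ∀ (σ σ' : Fin p → SignType), ∑ i, (signVector s σ i * signVector s σ' i) ^ 2 =
      (∑ i, (if σ i ≠ 0 then (1 : ℝ) else 0) * if σ' i ≠ 0 then 1 else 0) / s ^ 2 := by
    intro σ σ'
    rw [Finset.sum_div]
    refine Finset.sum_congr rfl fun i _ => ?_
    rw [mul_pow, signVector, signVector, div_pow, div_pow, signType_sq, signType_sq,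
      Real.sq_sqrt (Nat.cast_nonneg _), div_mul_div_comm, pow_two (s : ℝ)]
  have hle : 2 ^ p * ∑ σ ∈ signPatterns p s, ∑ σ' ∈ signPatterns p s,
      (∑ i, signVector s σ i * signVector s σ' i) ^ (2 * m) ≤
      2 ^ p * (matchingNumber m * ((s ^ 2 / p + m) ^ m / (s ^ 2) ^ m *
        ((signPatterns p s).card : ℝ) ^ 2)) := by
    rw [hflip]
    calc _ ≤ ∑ σ ∈ signPatterns p s, ∑ σ' ∈ signPatterns p s, 2 ^ p * (matchingNumber m *
          (∑ i, (signVector s σ i * signVector s σ' i) ^ 2) ^ m) :=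
          Finset.sum_le_sum fun σ _ => Finset.sum_le_sum fun σ' _ => sum_boolSign_pow_le _ m
      _ = 2 ^ p * (matchingNumber m * ((∑ σ ∈ signPatterns p s, ∑ σ' ∈ signPatterns p s,
          (∑ i, (if σ i ≠ 0 then (1 : ℝ) else 0) * if σ' i ≠ 0 then 1 else 0) ^ m) /
            (s ^ 2) ^ m)) := by
          simp only [hsq]
          simp only [div_pow]
          simp only [Finset.sum_div, Finset.mul_sum]
      _ ≤ _ := by
          rw [div_mul_eq_mul_div]
          have := sum_common_support_pow_le hs m
          have := matchingNumber_nonneg m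
          gcongr
  have hle' := le_of_mul_le_mul_left hle (by positivity)
  have hs' : (s : ℝ) ≠ 0 := Nat.cast_ne_zero.2 hs0
  have hform : (1 / p + m / s ^ 2 : ℝ) ^ m = (s ^ 2 / p + m : ℝ) ^ m / (s ^ 2 : ℝ) ^ m := by
    rw [← div_pow]
    congr 1
    field_simp
  rw [overlapMoment, hform]
  by_cases hN : ((signPatterns p s).card : ℝ) = 0
  · have := matchingNumber_nonneg m
    rw [hN, zero_pow two_ne_zero, _root_.inv_zero, zero_mul]
    positivity
  · rw [inv_mul_le_iff₀ (by positivity)]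
    refine hle'.trans (le_of_eq (by ring))

end Moments

/-! ### Boundedness of the low-degree norm -/

section LowDegree

lemma card_piAntidiag_univ (n e : ℕ) :
    (Finset.univ.piAntidiag e : Finset (Fin n → ℕ)).card = (n + e - 1).choose e := by
  rw [← Finset.map_sym_eq_piAntidiag, Finset.card_map, Finset.sym_univ, Finset.card_univ,
    Sym.card_sym_eq_choose, Fintype.card_fin]

/-- Stars and bars: `C(n+e-1, e)` ways to distribute a total degree `e` over `n` observations. -/
lemma sum_multiIndices_comp_sum (n E : ℕ) (u : ℕ → ℝ) :
    ∑ d ∈ multiIndices (Fin n) E, u (∑ k, d k) =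
      ∑ e ∈ Finset.range (E + 1), ((n + e - 1).choose e : ℝ) * u e := by
  have hmaps : ∀ d ∈ multiIndices (Fin n) E, ∑ k, d k ∈ Finset.range (E + 1) :=
    fun d hd => Finset.mem_range.2 (Nat.lt_succ_of_le (mem_multiIndices.1 hd))
  rw [← Finset.sum_fiberwise_of_maps_to hmaps]
  refine Finset.sum_congr rfl fun e he => ?_
  rw [Finset.sum_congr rfl fun d hd => by rw [(Finset.mem_filter.1 hd).2], Finset.sum_const,
    nsmul_eq_mul, ← card_piAntidiag_univ]
  congr 3
  ext d
  rw [Finset.mem_filter, mem_multiIndices, Finset.mem_piAntidiag]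
  have := Finset.mem_range.1 he
  constructor
  · rintro ⟨-, h⟩
    exact ⟨h, by simp⟩
  · rintro ⟨h, -⟩
    exact ⟨(show ∑ k, d k = e from h).trans_le (by omega), h⟩

/-- Equivalent to the bound `4^m` on the central binomial coefficient. It lets the `X`- and
`Y`-moments together cost only the factorial by which `C(n+e-1, e)` is divided. -/
lemma matchingNumber_sq_le (m : ℕ) : matchingNumber m ^ 2 ≤ (2 * m).factorial := by
  have h1 : ((2 * m).choose m : ℝ) ≤ (2 ^ m) ^ 2 := by
    rw [← pow_mul, mul_comm m 2]
    exact_mod_cast Nat.choose_le_two_pow (2 * m) m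
  have h2 : ((2 * m).choose m : ℝ) * m.factorial * m.factorial = (2 * m).factorial := by
    have := Nat.choose_mul_factorial_mul_factorial (show m ≤ 2 * m by omega)
    rw [show 2 * m - m = m by omega] at this
    exact_mod_cast this
  rw [matchingNumber, div_pow, div_le_iff₀ (by positivity), pow_two ((2 * m).factorial : ℝ)]
  gcongr
  rw [← h2, mul_pow]
  calc ((2 * m).choose m : ℝ) * m.factorial * m.factorial ≤
        (2 ^ m) ^ 2 * m.factorial * m.factorial := by gcongr
    _ = _ := by ring

/-- With `e ≥ 2`, the hypotheses give `p ≥ 6n/B²` and `s² ≥ 8nD/B²`. As `m ≤ D/4`, the sum is at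
most `(1/6 + 1/32) B²/n`, below `B²/(4n)`. -/
lemma overlap_base_le {B : ℝ} (hB : 1 < B) {n p s D m : ℕ} (hn : 1 ≤ n) (hD : 1 ≤ D)
    (hm : 4 * m ≤ D) (hp : 3 * Real.exp 1 * (n : ℝ) / B ^ 2 ≤ p)
    (hs : 2 * √(Real.exp 1 * (n : ℝ) * (D : ℝ)) / B ≤ s) :
    (1 / p + m / s ^ 2 : ℝ) ≤ B ^ 2 / (4 * n) := by
  have he : (2 : ℝ) ≤ Real.exp 1 := by
    have := Real.add_one_le_exp (1 : ℝ)
    linarith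
  have hn' : (1 : ℝ) ≤ n := by exact_mod_cast hn
  have hD' : (1 : ℝ) ≤ D := by exact_mod_cast hD
  have hm' : 4 * (m : ℝ) ≤ D := by exact_mod_cast hm
  have hp6 : 6 * n / B ^ 2 ≤ (p : ℝ) := by
    refine le_trans ?_ hp
    gcongr
    linarith
  have hs8 : 8 * n * D / B ^ 2 ≤ (s : ℝ) ^ 2 := by
    refine le_trans ?_ (pow_le_pow_left₀ (by positivity) hs 2)
    rw [div_pow, mul_pow, Real.sq_sqrt (by positivity)]
    refine div_le_div_of_nonneg_right ?_ (by positivity)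
    nlinarith [mul_pos (by linarith : (0 : ℝ) < n) (by linarith : (0 : ℝ) < D)]
  have h1 : (1 / p : ℝ) ≤ B ^ 2 / (6 * n) := by
    exact (one_div_le_one_div_of_le (by positivity) hp6).trans_eq (one_div_div _ _)
  have h2 : (m / s ^ 2 : ℝ) ≤ B ^ 2 / (32 * n) := by
    calc (m / s ^ 2 : ℝ) ≤ (D / 4) / (8 * n * D / B ^ 2) := by
          gcongr
          linarith
      _ = _ := by field_simp; norm_num
  calc (1 / p + m / s ^ 2 : ℝ) ≤ B ^ 2 / (6 * n) + B ^ 2 / (32 * n) := add_le_add h1 h2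
    _ = (19 / 24) * (B ^ 2 / (4 * n)) := by field_simp; norm_num
    _ ≤ B ^ 2 / (4 * n) := by
        have : 0 ≤ B ^ 2 / (4 * n) := by positivity
        linarith

lemma low_degree_term_le {B : ℝ} (hB : 1 < B) {n p q sx sy D e : ℕ} (hn : 1 ≤ n) (hD : 1 ≤ D)
    (hDn : D ≤ n) (he : 2 * e ≤ D) (hsxp : sx ≤ p) (hsyq : sy ≤ q) (hsx0 : sx ≠ 0) (hsy0 : sy ≠ 0)
    (hp : 3 * Real.exp 1 * (n : ℝ) / B ^ 2 ≤ p) (hq : 3 * Real.exp 1 * (n : ℝ) / B ^ 2 ≤ q)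
    (hsx : 2 * √(Real.exp 1 * (n : ℝ) * (D : ℝ)) / B ≤ sx)
    (hsy : 2 * √(Real.exp 1 * (n : ℝ) * (D : ℝ)) / B ≤ sy) :
    ((n + e - 1).choose e : ℝ) *
      ((1 / B) ^ (2 * e) * (overlapMoment p sx e * overlapMoment q sy e)) ≤ (1 / 2) ^ e := by
  rcases Nat.even_or_odd' e with ⟨m, rfl | rfl⟩
  · have hB0 : 0 < B := by linarith
    have hn' : (1 : ℝ) ≤ n := by exact_mod_cast hn
    have hx : overlapMoment p sx (2 * m) ≤ matchingNumber m * (B ^ 2 / (4 * n)) ^ m := by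
      refine (overlapMoment_even_le hsx0 hsxp m).trans ?_
      have := overlap_base_le hB hn hD (by omega : 4 * m ≤ D) hp hsx
      have := matchingNumber_nonneg m
      gcongr
    have hy : overlapMoment q sy (2 * m) ≤ matchingNumber m * (B ^ 2 / (4 * n)) ^ m := by
      refine (overlapMoment_even_le hsy0 hsyq m).trans ?_
      have := overlap_base_le hB hn hD (by omega : 4 * m ≤ D) hq hsy
      have := matchingNumber_nonneg m
      gcongr
    have hxy : overlapMoment p sx (2 * m) * overlapMoment q sy (2 * m) ≤
        (2 * m).factorial * (B ^ 2 / (4 * n)) ^ (2 * m) := by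
      have hnn := matchingNumber_nonneg m
      refine (mul_le_mul hx hy (overlapMoment_even_nonneg m) (by positivity)).trans ?_
      calc _ = matchingNumber m ^ 2 * (B ^ 2 / (4 * n)) ^ (2 * m) := by ring
        _ ≤ _ := by
          have := matchingNumber_sq_le m
          gcongr
    -- The constant `3/2` comes from `4m ≤ D ≤ n`. Multiplied by `1/4` from the overlap base, it
    -- leaves the ratio `3/8 < 1/2`.
    have hc : ((n + 2 * m - 1).choose (2 * m) : ℝ) ≤ (3 / 2 * n) ^ (2 * m) / (2 * m).factorial := by
      refine (Nat.choose_le_pow_div (2 * m) (n + 2 * m - 1)).trans ?_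
      have h1 : 2 * (n + 2 * m - 1) ≤ 3 * n := by omega
      have h2 : 2 * ((n + 2 * m - 1 : ℕ) : ℝ) ≤ 3 * n := by exact_mod_cast h1
      gcongr
      linarith
    have hxy0 : 0 ≤ overlapMoment p sx (2 * m) * overlapMoment q sy (2 * m) :=
      mul_nonneg (overlapMoment_even_nonneg m) (overlapMoment_even_nonneg m)
    calc _ ≤ (3 / 2 * n) ^ (2 * m) / (2 * m).factorial *
          ((1 / B) ^ (2 * (2 * m)) * ((2 * m).factorial * (B ^ 2 / (4 * n)) ^ (2 * m))) := by
          gcongr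
      _ = (3 / 2 * n * ((1 / B) ^ 2 * (B ^ 2 / (4 * n)))) ^ (2 * m) := by
          have hf : ((2 * m).factorial : ℝ) ≠ 0 := by positivity
          rw [mul_pow (3 / 2 * (n : ℝ)), mul_pow ((1 / B) ^ 2), pow_mul (1 / B), div_mul_eq_mul_div,
            mul_left_comm (((1 / B) ^ 2) ^ (2 * m)), mul_left_comm, mul_div_cancel_left₀ _ hf]
      _ = (3 / 8) ^ (2 * m) := by
          congr 1
          field_simp
          norm_num
      _ ≤ (1 / 2) ^ (2 * m) := pow_le_pow_left₀ (by norm_num) (by norm_num) _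
  · rw [overlapMoment_odd ⟨m, rfl⟩]
    simp

lemma signPatterns_nonempty {p s : ℕ} (hs : s ≤ p) : (signPatterns p s).Nonempty := by
  refine ⟨fun i => if (i : ℕ) < s then 1 else 0, mem_signPatterns.2 ?_⟩
  have h : (Finset.univ.filter fun i : Fin p => (if (i : ℕ) < s then (1 : SignType) else 0) ≠ 0) =
      Finset.univ.filter fun i : Fin p => (i : ℕ) < s := by
    ext i
    simp
  rw [h, Fin.card_filter_val_lt]
  exact min_eq_right hs

lemma lowDegreeNorm_plantedMixture_le {B : ℝ} (hB : 1 < B) {n p q sx sy D D' : ℕ} (hn : 1 ≤ n)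
    (hD : 1 ≤ D) (hDn : D ≤ n) (hD' : D' ≤ D) (hsxp : sx ≤ p) (hsyq : sy ≤ q) (hsx0 : sx ≠ 0)
    (hsy0 : sy ≠ 0) (hp : 3 * Real.exp 1 * (n : ℝ) / B ^ 2 ≤ p)
    (hq : 3 * Real.exp 1 * (n : ℝ) / B ^ 2 ≤ q)
    (hsx : 2 * √(Real.exp 1 * (n : ℝ) * (D : ℝ)) / B ≤ sx)
    (hsy : 2 * √(Real.exp 1 * (n : ℝ) * (D : ℝ)) / B ≤ sy) :
    lowDegreeNorm (plantedMixture n p q sx sy B) (iidLaw n (nullLaw p q)) D' ≤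
      ENNReal.ofReal 2 := by
  refine lowDegreeNorm_le zero_le_two (integrable_evalPoly_plantedMixture B
    (signPatterns_nonempty hsxp) (signPatterns_nonempty hsyq)) ?_
  rw [sum_sq_integral_hermiteProd_plantedMixture hB hsx0 hsy0, sum_multiIndices_comp_sum n (D' / 2)
    fun e => (1 / B) ^ (2 * e) * (overlapMoment p sx e * overlapMoment q sy e)]
  refine (Finset.sum_le_sum fun e he => low_degree_term_le hB hn hD hDn ?_ hsxp hsyq hsx0 hsy0
    hp hq hsx hsy).trans ?_
  · have := Finset.mem_range.1 he
    omega
  -- The squared norm is at most the geometric sum `2`, and `2 ≤ 2 ^ 2`.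
  · refine (Summable.sum_le_tsum _ (fun _ _ => by positivity) summable_geometric_two).trans ?_
    rw [tsum_geometric_two]
    norm_num

end LowDegree

/-! ### Regularity of the testing problem -/

section Regularity

lemma absolutelyContinuous_pi_fin {E : Type*} [MeasurableSpace E] {n : ℕ} {μ ν : Fin n → Measure E}
    [∀ i, SigmaFinite (μ i)] [∀ i, SigmaFinite (ν i)] (h : ∀ i, μ i ≪ ν i) :
    Measure.pi μ ≪ Measure.pi ν := by
  induction n with
  | zero =>
    rw [Measure.pi_of_empty, Measure.pi_of_empty]
  | succ n ih =>
    have hμ := (measurePreserving_piFinSuccAbove μ 0).symm.map_eq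
    have hν := (measurePreserving_piFinSuccAbove ν 0).symm.map_eq
    rw [← hμ, ← hν]
    exact ((h 0).prod (ih fun i => h _)).map (MeasurableEquiv.measurable _)

lemma absolutelyContinuous_pi {ι E : Type*} [Fintype ι] [MeasurableSpace E] {μ ν : ι → Measure E}
    [∀ i, SigmaFinite (μ i)] [∀ i, SigmaFinite (ν i)] (h : ∀ i, μ i ≪ ν i) :
    Measure.pi μ ≪ Measure.pi ν := by
  let e := (Fintype.equivFin ι).symm
  rw [← (measurePreserving_piCongrLeft μ e).map_eq, ← (measurePreserving_piCongrLeft ν e).map_eq]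
  exact (absolutelyContinuous_pi_fin fun i => h (e i)).map (MeasurableEquiv.measurable _)

variable {ι : Type*} [Fintype ι]

lemma stdGaussian_absolutelyContinuous :
    stdGaussian (EuclideanSpace ℝ ι) ≪ volume := by
  rw [← map_pi_eq_stdGaussian, ← (PiLp.volume_preserving_toLp ι).map_eq]
  exact (absolutelyContinuous_pi fun _ => gaussianReal_absolutelyContinuous 0 one_ne_zero).map
    (by fun_prop)

lemma absolutelyContinuous_stdGaussian :
    volume ≪ stdGaussian (EuclideanSpace ℝ ι) := by
  rw [← map_pi_eq_stdGaussian, ← (PiLp.volume_preserving_toLp ι).map_eq]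
  exact (absolutelyContinuous_pi fun _ => gaussianReal_absolutelyContinuous' 0 one_ne_zero).map
    (by fun_prop)

open scoped MatrixOrder in
-- The standard Gaussian and Lebesgue measure are mutually absolutely continuous, and the invertible
-- map `CFC.sqrt S` sends Lebesgue measure to a multiple of itself.
lemma multivariateGaussian_absolutelyContinuous [DecidableEq ι] {S : Matrix ι ι ℝ}
    (hS : S.PosDef) : multivariateGaussian 0 S ≪ multivariateGaussian 0 (1 : Matrix ι ι ℝ) := by
  rw [multivariateGaussian_zero_one]
  refine Measure.AbsolutelyContinuous.trans ?_ absolutelyContinuous_stdGaussian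
  have hsq : CFC.sqrt S * CFC.sqrt S = S := CFC.sqrt_mul_sqrt_self S hS.posSemidef.nonneg
  have hdet : LinearMap.det (toEuclideanCLM (𝕜 := ℝ) (CFC.sqrt S)).toLinearMap ≠ 0 := by
    intro h0
    have h1 : toEuclideanCLM (𝕜 := ℝ) (CFC.sqrt S) * toEuclideanCLM (𝕜 := ℝ) (CFC.sqrt S) *
        toEuclideanCLM (𝕜 := ℝ) S⁻¹ = 1 := by
      rw [← map_mul, ← map_mul, hsq, mul_nonsing_inv _ hS.det_pos.ne'.isUnit, map_one]
    have h2 := congrArg (fun f => LinearMap.det (ContinuousLinearMap.toLinearMap f)) h1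
    simp only [ContinuousLinearMap.toLinearMap_mul, map_mul, h0, zero_mul] at h2
    simp at h2
  have hmap : multivariateGaussian 0 S = (stdGaussian (EuclideanSpace ℝ ι)).map
      (toEuclideanCLM (𝕜 := ℝ) (CFC.sqrt S)).toLinearMap := by
    simp [multivariateGaussian]
  rw [hmap]
  refine (stdGaussian_absolutelyContinuous.map (by fun_prop)).trans ?_
  rw [Measure.map_linearMap_addHaar_eq_smul_addHaar _ hdet]
  exact Measure.smul_absolutelyContinuous

variable {n p q sx sy : ℕ} {B : ℝ}

instance isProbabilityMeasure_plantedLaw (a : Fin p → ℝ) (b : Fin q → ℝ) :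
    IsProbabilityMeasure (plantedLaw B a b) := by
  rw [plantedLaw]
  split_ifs <;> infer_instance

instance isProbabilityMeasure_iidLaw (μ : Measure (Obs p q)) [IsProbabilityMeasure μ] :
    IsProbabilityMeasure (iidLaw n μ) := by
  rw [iidLaw]
  infer_instance

/-- If all components of the mixture give mass at most `c` to a set, so does the mixture. -/
lemma plantedMixture_apply_le {s : Set (Sample n p q)} {c : ℝ≥0∞}
    (h : ∀ σ ∈ signPatterns p sx, ∀ τ ∈ signPatterns q sy,
      iidLaw n (plantedLaw B (signVector sx σ) (signVector sy τ)) s ≤ c) :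
    plantedMixture n p q sx sy B s ≤ c := by
  rw [plantedMixture, Measure.smul_apply, Measure.finsetSum_apply, smul_eq_mul]
  simp only [Measure.finsetSum_apply]
  calc _ ≤ (((signPatterns p sx).card * (signPatterns q sy).card : ℕ) : ℝ≥0∞)⁻¹ *
        ∑ σ ∈ signPatterns p sx, ∑ τ ∈ signPatterns q sy, c := by
        gcongr with σ hσ τ hτ
        exact h σ hσ τ hτ
    _ = (((signPatterns p sx).card * (signPatterns q sy).card : ℕ) : ℝ≥0∞)⁻¹ *
        ((signPatterns p sx).card * (signPatterns q sy).card : ℕ) * c := by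
        simp [mul_assoc]
    _ ≤ 1 * c := by
        gcongr
        exact ENNReal.inv_mul_le_one _
    _ = c := one_mul c

lemma isProbabilityMeasure_plantedMixture (hsxp : sx ≤ p) (hsyq : sy ≤ q) :
    IsProbabilityMeasure (plantedMixture n p q sx sy B) := by
  constructor
  rw [plantedMixture, Measure.smul_apply, Measure.finsetSum_apply, smul_eq_mul]
  simp only [Measure.finsetSum_apply, measure_univ, Finset.sum_const, nsmul_eq_mul, mul_one]
  rw [← Nat.cast_mul]
  refine ENNReal.inv_mul_cancel ?_ (ENNReal.natCast_ne_top _)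
  exact_mod_cast (mul_pos (signPatterns_nonempty hsxp).card_pos
    (signPatterns_nonempty hsyq).card_pos).ne'

lemma plantedMixture_absolutelyContinuous (hB : 1 < B) (hsx : sx ≠ 0) (hsy : sy ≠ 0) :
    plantedMixture n p q sx sy B ≪ iidLaw n (nullLaw p q) := by
  intro s hs
  refine le_antisymm (plantedMixture_apply_le fun σ hσ τ hτ => ?_) zero_le
  rw [plantedLaw_signVector hB hsx hsy hσ hτ]
  refine (absolutelyContinuous_pi (ν := fun _ => nullLaw p q) (fun _ => ?_) hs).le
  exact multivariateGaussian_absolutelyContinuous (posDef_spikedCov_signVector hB hsx hsy hσ hτ)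

lemma isRegular_plantedMixture (hB : 1 < B) (hsxp : sx ≤ p) (hsyq : sy ≤ q) (hsx : sx ≠ 0)
    (hsy : sy ≠ 0) : IsRegular (plantedMixture n p q sx sy B) (iidLaw n (nullLaw p q)) where
  prob_P := isProbabilityMeasure_plantedMixture hsxp hsyq
  prob_Q := inferInstance
  absolutelyContinuous := plantedMixture_absolutelyContinuous hB hsx hsy
  integrable := integrable_evalPoly_plantedMixture B (signPatterns_nonempty hsxp)
    (signPatterns_nonempty hsyq)
  memLp f := by
    have hint := integrable_evalPoly_iidLaw (n := n)
      (1 : Matrix (Fin p ⊕ Fin q) (Fin p ⊕ Fin q) ℝ)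
    refine (memLp_two_iff_integrable_sq (hint f).aestronglyMeasurable).2 ?_
    refine (hint (f ^ 2)).congr (ae_of_all _ fun x => ?_)
    simp only [evalPoly, map_pow]

end Regularity

/-! ### The planted laws belong to the model -/

section Membership

variable {p q sx sy : ℕ} {B : ℝ}

lemma signVector_ne_zero {s : ℕ} (hs : s ≠ 0) {σ : Fin p → SignType} {i : Fin p} :
    signVector s σ i ≠ 0 ↔ σ i ≠ 0 := by
  have : √(s : ℝ) ≠ 0 := by positivity
  simp only [signVector, ne_eq, div_eq_zero_iff, this, or_false]
  cases σ i <;> simp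

lemma card_rowSupport_signVector {s : ℕ} (hs : s ≠ 0) {σ : Fin p → SignType}
    (h : σ ∈ signPatterns p s) :
    (rowSupport (of fun i (_ : Fin 1) => signVector s σ i)).card = s := by
  refine Eq.trans ?_ (mem_signPatterns.1 h)
  rw [rowSupport]
  congr 1
  ext i
  simp only [Finset.mem_filter, Finset.mem_univ, true_and]
  rw [← signVector_ne_zero hs, Function.ne_iff]
  simp

/-- The cross form is `(1/B) ⟨a,u⟩ ⟨b,v⟩`, and the constraints are unit spheres because both
diagonal blocks are the identity. By Cauchy–Schwarz the maximum is `1/B`, attained at `(a, b)`. With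
one pair of directions the gap condition is vacuous. -/
lemma inModel_plantedLaw (hB : 1 < B) (hsx : sx ≠ 0) (hsy : sy ≠ 0)
    {σ : Fin p → SignType} (hσ : σ ∈ signPatterns p sx)
    {τ : Fin q → SignType} (hτ : τ ∈ signPatterns q sy) :
    InModel sx sy B (plantedLaw B (signVector sx σ) (signVector sy τ))
      (of fun i (_ : Fin 1) => signVector sx σ i) (of fun j (_ : Fin 1) => signVector sy τ j) := by
  have ha := sum_signVector_sq hsx hσ
  have hb := sum_signVector_sq hsy hτ
  set a := signVector sx σ
  set b := signVector sy τ
  have hB0 : 0 < B := by linarith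
  have hBinv : 1 / B < 1 := (div_lt_one hB0).2 hB
  have hval : ∀ (u : Fin p → ℝ) (v : Fin q → ℝ),
      u ⬝ᵥ ((spikedCov a b (1 / B)).toBlocks₁₂ *ᵥ v) = 1 / B * ((a ⬝ᵥ u) * (b ⬝ᵥ v)) := by
    intro u v
    rw [spikedCov, toBlocks_fromBlocks₁₂, smul_mulVec, dotProduct_smul, vecMulVec_mulVec,
      smul_eq_mul]
    simp [dotProduct_smul, dotProduct_comm u a, mul_comm]
  have haa : a ⬝ᵥ a = 1 := by simpa [dotProduct, pow_two] using ha
  have hbb : b ⬝ᵥ b = 1 := by simpa [dotProduct, pow_two] using hb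
  refine ⟨⟨spikedCov a b (1 / B), (posDef_spikedCov_signVector hB hsx hsy hσ hτ).posSemidef,
    plantedLaw_signVector hB hsx hsy hσ hτ, ?_, ?_, ?_, ?_, ?_, ?_, ?_, ?_⟩,
    card_rowSupport_signVector hsx hσ, card_rowSupport_signVector hsy hτ⟩
  · rw [spikedCov, toBlocks_fromBlocks₁₂, ← smul_vecMulVec]
    -- The rank is not zero: the cross form takes the value `1/B` at `(a, b)`.
    refine le_antisymm (rank_vecMulVec_le _ _) (Nat.one_le_iff_ne_zero.2 fun h0 => ?_)
    rw [Matrix.rank, Submodule.finrank_eq_zero, LinearMap.range_eq_bot] at h0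
    have h1 := congrArg (a ⬝ᵥ ·) (LinearMap.congr_fun h0 b)
    have h2 := hval a b
    rw [spikedCov, toBlocks_fromBlocks₁₂, ← smul_vecMulVec] at h2
    simp only [mulVecLin_apply, h2, haa, hbb, LinearMap.zero_apply, dotProduct_zero] at h1
    have : 0 < 1 / B := by positivity
    linarith
  · intro j
    have hcol : (of fun i (_ : Fin 1) => a i).col j = a := rfl
    have hcol' : (of fun i (_ : Fin 1) => b i).col j = b := rfl
    simp only [hcol, hcol', isMaxOn_iff, hval, haa, hbb]
    refine ⟨⟨?_, ?_, fun l hl => ?_⟩, ?_⟩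
    · simpa [spikedCov] using haa
    · simpa [spikedCov] using hbb
    · exact absurd hl (by simp [Subsingleton.elim l j])
    · rintro ⟨u, v⟩ ⟨hu, hv, -⟩
      have hu' : ∑ i, u i ^ 2 = 1 := by simpa [spikedCov, dotProduct, pow_two] using hu
      have hv' : ∑ i, v i ^ 2 = 1 := by simpa [spikedCov, dotProduct, pow_two] using hv
      have h1 := Finset.sum_mul_sq_le_sq_mul_sq Finset.univ a u
      have h2 := Finset.sum_mul_sq_le_sq_mul_sq Finset.univ b v
      rw [ha, hu'] at h1
      rw [hb, hv'] at h2
      refine mul_le_mul_of_nonneg_left ?_ (by positivity)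
      change (∑ i, a i * u i) * (∑ i, b i * v i) ≤ 1 * 1
      nlinarith [sq_nonneg ((∑ i, a i * u i) - ∑ i, b i * v i)]
  · intro j
    refine le_of_eq ?_
    have h := hval a b
    rw [haa, hbb, mul_one, mul_one] at h
    exact h.symm
  · intro i j h
    omega
  -- The four differences are `(1 - 1/B) I` and `(B - 1) I`, positive since `1 < B`.
  all_goals
    simp only [spikedCov, toBlocks_fromBlocks₁₁, toBlocks_fromBlocks₂₂]
    rw [← one_smul ℝ (1 : Matrix _ _ ℝ), smul_smul, mul_one, ← sub_smul]
    exact PosDef.one.smul (by linarith)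

lemma plantedLaw_mem_modelG {r : ℕ} (hr : 1 ≤ r) (hB : 1 < B) (hsx : sx ≠ 0) (hsy : sy ≠ 0)
    {σ : Fin p → SignType} (hσ : σ ∈ signPatterns p sx)
    {τ : Fin q → SignType} (hτ : τ ∈ signPatterns q sy) :
    plantedLaw B (signVector sx σ) (signVector sy τ) ∈ modelG p q r sx sy B :=
  ⟨1, le_rfl, hr, _, _, inModel_plantedLaw hB hsx hsy hσ hτ⟩

end Membership

/-! ### Reduction to the low-degree conjecture -/

section Reduction

/-- Sample sizes with error below `1/(k+1)` are extracted along a strictly increasing sequence; its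
range is the infinite set on which the conjecture is applied. -/
lemma exists_infinite_tendsto_of_liminf_eq_zero {a : ℕ → ℝ≥0∞} (h : liminf a atTop = 0) :
    ∃ N : Set ℕ, N.Infinite ∧ Tendsto a (along N) (𝓝 0) := by
  have hfreq : ∀ k : ℕ, ∃ᶠ n in atTop, a n < ((k : ℝ≥0∞) + 1)⁻¹ := fun k =>
    frequently_lt_of_liminf_lt (by isBoundedDefault) (by rw [h]; simp)
  obtain ⟨φ, hφ, hlt⟩ := extraction_forall_of_frequently hfreq
  refine ⟨Set.range φ, Set.infinite_range_of_injective hφ.injective,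
    ENNReal.tendsto_nhds_zero.2 fun ε hε => ?_⟩
  obtain ⟨K, hK⟩ := ENNReal.exists_inv_nat_lt hε.ne'
  rw [along, eventually_inf_principal]
  filter_upwards [eventually_ge_atTop (φ K)]
  rintro _ hn ⟨k, rfl⟩
  have hk : K ≤ k := hφ.le_iff_le.1 hn
  refine (hlt k).le.trans (le_trans (ENNReal.inv_le_inv.2 ?_) hK.le)
  have : (K : ℝ≥0∞) ≤ k := by exact_mod_cast hk
  exact this.trans le_self_add

lemma IsTimeTest.mono {p q : ℕ → ℕ} {N N' : Set ℕ} {t : ℕ → ℕ}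
    {Φ : ∀ n, Sample n (p n) (q n) → Bool} (h : IsTimeTest N' t Φ) (hN : N ⊆ N') :
    IsTimeTest N t Φ := by
  obtain ⟨prog, K, hK⟩ := h
  exact ⟨prog, K, hK.filter_mono (inf_le_inf_left _ (principal_mono.2 hN))⟩

/-- The test that rejects when a decoder returns a nonempty set is computed by the same program. -/
lemma IsTimeDecoder.isTimeTest {p q : ℕ → ℕ} {t : ℕ → ℕ}
    {dec : ∀ n, Sample n (p n) (q n) → Finset ℕ} (h : IsTimeDecoder t dec) :
    IsTimeTest Set.univ t fun n x => decide (dec n x ≠ ∅) := by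
  obtain ⟨prog, K, hK⟩ := h
  refine ⟨prog, K, ?_⟩
  rw [along, principal_univ, inf_top_eq]
  filter_upwards [hK] with n hn
  refine ⟨hn.1, fun x => ?_⟩
  obtain ⟨s, hs, hdec⟩ := hn.2 x
  refine ⟨s, hs, ?_⟩
  -- The output set is empty iff its recorded length `idx 0` is zero, so the decoder's length
  -- register already serves as the decision register of the test.
  rw [decide_eq_true_iff, hdec, Config.output, ne_eq, Finset.image_eq_empty,
    Finset.range_eq_empty_iff]

/-- Recovery of the supports implies detection. -/
lemma RecoversSupport.stronglyDistinguishesClass {p q : ℕ → ℕ} {r : ℕ} {sx sy : ℕ → ℕ} {B : ℝ}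
    {decx decy : ∀ n, Sample n (p n) (q n) → Finset ℕ}
    (h : RecoversSupport r sx sy B decx decy) (hsx : ∀ᶠ n in atTop, sx n ≠ 0) :
    StronglyDistinguishesClass (fun n => modelG (p n) (q n) r (sx n) (sy n) B)
      fun n x => decide (decx n x ≠ ∅) := by
  refine Tendsto.liminf_eq ?_
  have hlim := h.2.1.add h.1
  rw [add_zero] at hlim
  refine tendsto_of_tendsto_of_tendsto_of_le_of_le' tendsto_const_nhds hlim
    (Eventually.of_forall fun _ => zero_le) ?_
  filter_upwards [hsx] with n hn
  refine add_le_add (by simp) (iSup₂_le fun μ hμ => ?_)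
  obtain ⟨k, hk, hkr, U, V, hUV⟩ := hμ
  refine le_trans (measure_mono fun x hx => ?_)
    (le_iSup_of_le k (le_iSup_of_le ⟨hk, hkr⟩ (le_iSup_of_le μ (le_iSup_of_le U
      (le_iSup_of_le V (le_iSup_of_le hUV le_rfl))))))
  rintro ⟨hx', -⟩
  have hempty : decx n x = ∅ := by simpa using hx
  rw [hempty, eq_comm, Finset.image_eq_empty] at hx'
  have := hUV.card_x
  rw [hx', Finset.card_empty] at this
  exact hn this.symm

end Reduction

end SparseCCA

/-! ### The computational lower bound -/

theorem corollary1
    (Nice : SparseCCA.TestingSequence → Prop) (C : ℕ)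
    (hconj : SparseCCA.LowDegreeConjecture Nice C)
    (B : ℝ) (hB : 1 < B) (r : ℕ) (hr : 1 ≤ r)
    (p q sx sy D : ℕ → ℕ)
    (hsxp : ∀ᶠ n : ℕ in Filter.atTop, sx n ≤ p n)
    (hsyq : ∀ᶠ n : ℕ in Filter.atTop, sy n ≤ q n)
    (hsx : ∀ᶠ n : ℕ in Filter.atTop, 2 * √(Real.exp 1 * (n : ℝ) * (D n : ℝ)) / B ≤ (sx n : ℝ))
    (hsy : ∀ᶠ n : ℕ in Filter.atTop, 2 * √(Real.exp 1 * (n : ℝ) * (D n : ℝ)) / B ≤ (sy n : ℝ))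
    (hp : ∀ᶠ n : ℕ in Filter.atTop, 3 * Real.exp 1 * (n : ℝ) / B ^ 2 ≤ (p n : ℝ))
    (hq : ∀ᶠ n : ℕ in Filter.atTop, 3 * Real.exp 1 * (n : ℝ) / B ^ 2 ≤ (q n : ℝ))
    (hD : ∀ᶠ n : ℕ in Filter.atTop, (D n : ℝ) ≤ min √(p n : ℝ) (min √(q n : ℝ) (n : ℝ)))
    (hNice : Nice (SparseCCA.plantedSequence p q sx sy B))
    (t : ℕ → ℕ) (ht : ∀ n, 1 ≤ t n)
    (htD : ∀ᶠ n : ℕ in Filter.atTop, (t n : ℝ) * Real.log (n : ℝ) ^ C ≤ (D n : ℝ)) :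
    (∀ Φ : ∀ n, SparseCCA.Sample n (p n) (q n) → Bool,
      SparseCCA.IsTimeTest Set.univ t Φ →
        ¬ SparseCCA.StronglyDistinguishesClass
          (fun n => SparseCCA.modelG (p n) (q n) r (sx n) (sy n) B) Φ) ∧
    (∀ decx decy : ∀ n, SparseCCA.Sample n (p n) (q n) → Finset ℕ,
      SparseCCA.IsTimeDecoder t decx → SparseCCA.IsTimeDecoder t decy →
        ¬ SparseCCA.RecoversSupport r sx sy B decx decy) := by
  -- For `n ≥ 3` the logarithm is positive, so `t n * log n ^ C ≤ D n` forces `D n ≥ 1`. The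
  -- sparsity bounds then make `sx n` and `sy n` nonzero.
  have hDpos : ∀ᶠ n : ℕ in Filter.atTop, 1 ≤ n ∧ 1 ≤ D n := by
    filter_upwards [htD, Filter.eventually_ge_atTop 3] with n hn hn3
    refine ⟨by omega, ?_⟩
    have hlog : 0 < Real.log (n : ℝ) := Real.log_pos (by exact_mod_cast (by omega : 1 < n))
    have ht1 : (0 : ℝ) < t n := by exact_mod_cast ht n
    have h0 : (0 : ℝ) < D n := lt_of_lt_of_le (by positivity) hn
    exact_mod_cast h0
  have hne : ∀ s : ℕ → ℕ, (∀ᶠ n : ℕ in Filter.atTop,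
      2 * √(Real.exp 1 * (n : ℝ) * (D n : ℝ)) / B ≤ (s n : ℝ)) →
      ∀ᶠ n : ℕ in Filter.atTop, s n ≠ 0 := by
    intro s hs
    filter_upwards [hs, hDpos] with n hn hn1 h0
    have h1 : (0 : ℝ) < n := by exact_mod_cast hn1.1
    have h2 : (0 : ℝ) < D n := by exact_mod_cast hn1.2
    have h3 : 0 < 2 * √(Real.exp 1 * (n : ℝ) * (D n : ℝ)) / B := by positivity
    rw [h0, Nat.cast_zero] at hn
    linarith
  have hsx0 := hne sx hsx
  have hsy0 := hne sy hsy
  have hdetect : ∀ Φ : ∀ n, SparseCCA.Sample n (p n) (q n) → Bool,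
      SparseCCA.IsTimeTest Set.univ t Φ →
        ¬ SparseCCA.StronglyDistinguishesClass
          (fun n => SparseCCA.modelG (p n) (q n) r (sx n) (sy n) B) Φ := by
    intro Φ hΦ hdist
    obtain ⟨N, hN, hlim⟩ := SparseCCA.exists_infinite_tendsto_of_liminf_eq_zero hdist
    have hle : SparseCCA.along N ≤ Filter.atTop := inf_le_left
    refine hconj (SparseCCA.plantedSequence p q sx sy B) hNice N hN ?_ t ht ?_ Φ
      (hΦ.mono (Set.subset_univ N)) ⟨?_, ?_⟩
    · refine Filter.Eventually.filter_mono hle ?_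
      filter_upwards [hsxp, hsyq, hsx0, hsy0] with n h1 h2 h3 h4
      exact SparseCCA.isRegular_plantedMixture hB h1 h2 h3 h4
    · intro D' hD'
      refine ⟨2, ?_⟩
      filter_upwards [hD', hle hDpos, hle htD, hle hD, hle hsxp, hle hsyq, hle hsx0, hle hsy0,
        hle hp, hle hq, hle hsx, hle hsy] with n h1 h2 h3 h4 h5 h6 h7 h8 h9 h10 h11 h12
      have hDn : (D n : ℝ) ≤ n := h4.trans ((min_le_right _ _).trans (min_le_right _ _))
      exact SparseCCA.lowDegreeNorm_plantedMixture_le hB h2.1 h2.2 (by exact_mod_cast hDn)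
        (by exact_mod_cast h1.trans h3) h5 h6 h7 h8 h9 h10 h11 h12
    · exact tendsto_of_tendsto_of_tendsto_of_le_of_le tendsto_const_nhds hlim
        (fun _ => zero_le) fun _ => le_self_add
    -- The type II error of the mixture is at most that of its worst component, and every component
    -- belongs to the model.
    · refine tendsto_of_tendsto_of_tendsto_of_le_of_le' tendsto_const_nhds hlim
        (Filter.Eventually.of_forall fun _ => zero_le) (Filter.Eventually.filter_mono hle ?_)
      filter_upwards [hsx0, hsy0] with n h1 h2
      refine (SparseCCA.plantedMixture_apply_le fun σ hσ τ hτ => ?_).trans le_add_self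
      exact le_iSup₂_of_le _ (SparseCCA.plantedLaw_mem_modelG hr hB h1 h2 hσ hτ) le_rfl
  exact ⟨hdetect, fun decx decy hx _ hrec =>
    hdetect _ hx.isTimeTest (hrec.stronglyDistinguishesClass hsx0)⟩
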